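/- **Theorem 1.1 (maximum principle).** Let $(M,g)$ be a closed connected smooth Riemannian manifold of dimension $n\ge 3$, and let $\Delta_g=-\operatorname{div}_g\nabla$ be its Laplace–Beltrami operator. Let $f:M\to\mathbb{R}$ be a proper isoparametric function with image $[t_0,t_1]$, that is: $f$ is smooth and non-constant, there are smooth functions $a,b$ on $[t_0,t_1]$ with $\|\nabla f\|^2=b\circ f$ and $\Delta_g f=a\circ f$, and the focal sets $M_0=f^{-1}(t_0)$ and $M_1=f^{-1}(t_1)$ are embedded submanifolds of codimension greater than $1$. Put $S=M_0\cup M_1$ and $d(x)=d_g(S,x)$. A function on $M$ is called $f$-invariant if it is constant on each level set of $f$. Let $K:M\to\mathbb{R}$ be continuous and $f$-invariant, let $s\in(0,2)$ and $q>2$. If $u\in C^0(M)\cap C^2(M\setminus S)$ is non-negative, $f$-invariant, and satisfies $$\Delta_g u(x)+K(x)\,u(x)=\frac{u(x)^{q-1}}{d(x)^s}\qquad\text{for all }x\in M\setminus S,$$ then either $u\equiv 0$ on $M$, or $u(x)>0$ for every $x\in M$ (including the points of $M_0$ and $M_1$). -/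

import Mathlib

open Set Bundle
open scoped Manifold ContDiff

noncomputable section

namespace Isoparametric

section Manifold

variable {n : ℕ} {M : Type*} [TopologicalSpace M] [ChartedSpace (EuclideanSpace ℝ (Fin n)) M]

/-- `N` is, near the point `x`, an embedded smooth submanifold of dimension `d`: there is a smooth
chart around `x` in which `N` is a `d`-dimensional linear slice. -/
def IsSubmanifoldAt (d : ℕ) (N : Set M) (x : M) : Prop :=
  ∃ ψ ∈ IsManifold.maximalAtlas (𝓡 n) ∞ M, x ∈ ψ.source ∧
    ∃ V : Submodule ℝ (EuclideanSpace ℝ (Fin n)), Module.finrank ℝ V = d ∧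
      ∀ y ∈ ψ.source, y ∈ N ↔ ψ y - ψ x ∈ V

variable (n) in
/-- `N` is an embedded smooth submanifold of the `n`-manifold `M` all of whose components have
codimension greater than one. -/
def IsSubmanifoldOfCodimGtOne (N : Set M) : Prop :=
  ∀ x ∈ N, ∃ d : ℕ, d + 1 < n ∧ IsSubmanifoldAt (n := n) d N x

/-- The partial derivative at `y` of `h` in the `i`-th coordinate direction. -/
def partialDeriv (i : Fin n) (h : EuclideanSpace ℝ (Fin n) → ℝ)
    (y : EuclideanSpace ℝ (Fin n)) : ℝ :=
  fderiv ℝ h y (EuclideanSpace.single i 1)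

/-- The `i`-th coordinate vector field of the chart `ψ`, at the point of `M` with coordinates
`y`. -/
def coordVector (ψ : OpenPartialHomeomorph M (EuclideanSpace ℝ (Fin n)))
    (i : Fin n) (y : EuclideanSpace ℝ (Fin n)) : TangentSpace (𝓡 n) (ψ.symm y) :=
  mfderiv (𝓡 n) (𝓡 n) ψ.symm y
    (show TangentSpace (𝓡 n) y from EuclideanSpace.single i (1 : ℝ))

variable [RiemannianBundle (fun x : M ↦ TangentSpace (𝓡 n) x)]

variable (n) in
/-- The Riemannian gradient of `f` at `x`: the tangent vector representing the differential. -/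
def grad (f : M → ℝ) (x : M) : TangentSpace (𝓡 n) x :=
  letI : FiniteDimensional ℝ (TangentSpace (𝓡 n) x) :=
    inferInstanceAs (FiniteDimensional ℝ (EuclideanSpace ℝ (Fin n)))
  letI : CompleteSpace (TangentSpace (𝓡 n) x) := FiniteDimensional.complete ℝ _
  (InnerProductSpace.toDual ℝ (TangentSpace (𝓡 n) x)).symm (mfderiv (𝓡 n) 𝓘(ℝ, ℝ) f x)

/-- The matrix `(g i j)` of the Riemannian metric in the chart `ψ`. -/
def metricMatrix (ψ : OpenPartialHomeomorph M (EuclideanSpace ℝ (Fin n)))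
    (y : EuclideanSpace ℝ (Fin n)) : Matrix (Fin n) (Fin n) ℝ :=
  Matrix.of fun i j ↦ inner ℝ (coordVector ψ i y) (coordVector ψ j y)

variable (n) in
/-- The Laplace-Beltrami operator with the geometers' sign, `Δ u = - div (∇ u)`, by the usual
formula `- (det g)^(-1/2) ∑ i, ∂ᵢ ((det g)^(1/2) ∑ j, gⁱʲ ∂ⱼ u)` in the preferred chart at `x`. -/
def laplacian (u : M → ℝ) (x : M) : ℝ :=
  let ψ := chartAt (EuclideanSpace ℝ (Fin n)) x
  let G : EuclideanSpace ℝ (Fin n) → ℝ := fun y ↦ Real.sqrt (metricMatrix ψ y).det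
  let X : Fin n → EuclideanSpace ℝ (Fin n) → ℝ := fun i y ↦
    ∑ j, (metricMatrix ψ y)⁻¹ i j * partialDeriv j (u ∘ ψ.symm) y
  (-1) * (1 / G (ψ x)) * ∑ i, partialDeriv i (fun y ↦ G y * X i y) (ψ x)

/-- The set where `f` attains its minimum. -/
def minLevel {X : Type*} (f : X → ℝ) : Set X := {x | ∀ y, f x ≤ f y}

/-- The set where `f` attains its maximum. -/
def maxLevel {X : Type*} (f : X → ℝ) : Set X := {x | ∀ y, f y ≤ f x}

/-- The union of the two extremal level sets of `f`, the focal set if `f` is isoparametric. -/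
def focalSet {X : Type*} (f : X → ℝ) : Set X := minLevel f ∪ maxLevel f

variable (n) in
/-- `f` is an isoparametric function: smooth, non-constant, and such that `|∇ f|²` and `Δ f` are
smooth functions of `f` on the interval `[min f, max f]`. -/
structure IsIsoparametric (f : M → ℝ) : Prop where
  contMDiff : ContMDiff (𝓡 n) 𝓘(ℝ, ℝ) ∞ f
  nonconstant : ∃ x y, f x ≠ f y
  exists_gradient : ∃ b : ℝ → ℝ, ContDiffOn ℝ ∞ b (Icc (⨅ x, f x) (⨆ x, f x)) ∧
    ∀ x, ‖grad n f x‖ ^ 2 = b (f x)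
  exists_laplacian : ∃ a : ℝ → ℝ, ContDiffOn ℝ ∞ a (Icc (⨅ x, f x) (⨆ x, f x)) ∧
    ∀ x, laplacian n f x = a (f x)

variable (n) in
/-- An isoparametric function is proper if its two focal submanifolds have codimension greater
than one. -/
structure IsProperIsoparametric (f : M → ℝ) : Prop extends IsIsoparametric n f where
  minLevel_codim : IsSubmanifoldOfCodimGtOne n (minLevel f)
  maxLevel_codim : IsSubmanifoldOfCodimGtOne n (maxLevel f)

/-- `u` is `f`-invariant: constant along the level sets of `f`. -/
def IsInvariant {X : Type*} (f u : X → ℝ) : Prop := ∀ x y, f x = f y → u x = u y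

end Manifold

end Isoparametric

end

noncomputable section

open Filter Topology

namespace Isoparametric

/-! ### The metric and the gradient in coordinates. -/

section Metric

variable {n : ℕ} {M : Type*} [TopologicalSpace M] [ChartedSpace (EuclideanSpace ℝ (Fin n)) M]
  {ψ : OpenPartialHomeomorph M (EuclideanSpace ℝ (Fin n))} {y : EuclideanSpace ℝ (Fin n)}

/-! Write `u = φ ∘ f`. With `α = min f` and `γ = max f`, the chain rule for the Laplacian turns the
equation into the ODE `b φ'' - a φ' = K φ - φ^(q-1) / d^s` on `(α, γ)`, where `|∇f|² = b ∘ f` and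
`Δf = a ∘ f`. It has to be shown that one zero of `φ ≥ 0` forces `φ = 0`.

The profile `b` is positive inside the interval and has a simple zero at `α`. At a double zero `c`,
`|∇f|` would be bounded by a multiple of `|f - c|`; by Grönwall the level `f = c` would be open,
hence everything by connectedness (`derivWithin_ne_zero_of_eq_zero`, `profile_pos`). At an interior
zero, minimality gives `φ = φ' = 0`. As `q > 2`, the nonlinear term is `φ` times a locally bounded
coefficient, so uniqueness for linear equations gives `φ = 0` (`eq_zero_of_abs_deriv_deriv_le`).

A zero at `α` is the delicate case, since the ODE is singular there. Let `β = b'(α) > 0`. Expanding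
`|∇f|² = b ∘ f` to second order at a minimum shows that `(2/β) g⁻¹ Hess f` is a projection, whose
rank is at least the codimension of the minimum level; codimension at least two gives `-a(α) ≥ β`
(`le_neg_laplacian_of_mem_minLevel`). Hence `a + b' ≤ L (t - α)`, and the flux `W = b φ'` satisfies
`W' ≤ C W + k φ` where it is positive. A flux that stays above a positive constant would make `φ`
diverge logarithmically to `-∞` at `α`. So `φ'` is bounded by a multiple of the maximum of `φ`, and
on a short interval `φ(α) = 0` forces `φ = 0` (`flux_le`, `exists_eq_zero_near_endpoint`); interior
uniqueness finishes. The maximum level is treated by passing to `-f`. -/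

lemma mdifferentiable_of_mem_maximalAtlas [IsManifold (𝓡 n) ∞ M]
    (hψ : ψ ∈ IsManifold.maximalAtlas (𝓡 n) ∞ M) : ψ.MDifferentiable (𝓡 n) (𝓡 n) :=
  ⟨(contMDiffOn_of_mem_maximalAtlas hψ).mdifferentiableOn (by simp),
    (contMDiffOn_symm_of_mem_maximalAtlas hψ).mdifferentiableOn (by simp)⟩

lemma linearIndependent_coordVector [IsManifold (𝓡 n) ∞ M]
    (hψ : ψ ∈ IsManifold.maximalAtlas (𝓡 n) ∞ M) (hy : y ∈ ψ.target) :
    LinearIndependent ℝ (fun i ↦ coordVector ψ i y) := by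
  have h := (mdifferentiable_of_mem_maximalAtlas hψ).symm.ker_mfderiv_eq_bot hy
  have h2 := (EuclideanSpace.basisFun (Fin n) ℝ).toBasis.linearIndependent
  have h3 := h2.map' _ h
  convert! h3 using 1
  ext i
  simp [coordVector]
  rfl

lemma mfderiv_coordVector [IsManifold (𝓡 n) ∞ M]
    (hψ : ψ ∈ IsManifold.maximalAtlas (𝓡 n) ∞ M) (hy : y ∈ ψ.target) {f : M → ℝ}
    (hf : MDifferentiableAt (𝓡 n) 𝓘(ℝ, ℝ) f (ψ.symm y)) (i : Fin n) :
    mfderiv (𝓡 n) 𝓘(ℝ, ℝ) f (ψ.symm y) (coordVector ψ i y) = partialDeriv i (f ∘ ψ.symm) y := by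
  have h := mfderiv_comp y hf ((mdifferentiable_of_mem_maximalAtlas hψ).mdifferentiableAt_symm hy)
  rw [partialDeriv, ← mfderiv_eq_fderiv, h]
  rfl

variable [RiemannianBundle (fun x : M ↦ TangentSpace (𝓡 n) x)]

lemma inner_grad (f : M → ℝ) (x : M) (v : TangentSpace (𝓡 n) x) :
    inner ℝ (grad n f x) v = mfderiv (𝓡 n) 𝓘(ℝ, ℝ) f x v := by
  have : FiniteDimensional ℝ (TangentSpace (𝓡 n) x) :=
    inferInstanceAs (FiniteDimensional ℝ (EuclideanSpace ℝ (Fin n)))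
  have : CompleteSpace (TangentSpace (𝓡 n) x) := FiniteDimensional.complete ℝ _
  exact InnerProductSpace.toDual_symm_apply (𝕜 := ℝ) (E := TangentSpace (𝓡 n) x)

variable [IsManifold (𝓡 n) ∞ M]

lemma metricMatrix_posDef
    (hψ : ψ ∈ IsManifold.maximalAtlas (𝓡 n) ∞ M) (hy : y ∈ ψ.target) :
    (metricMatrix ψ y).PosDef :=
  Matrix.posDef_gram_of_linearIndependent (linearIndependent_coordVector hψ hy)

/-- Cauchy–Schwarz for the gradient against a coordinate field. -/
lemma partialDeriv_sq_le
    (hψ : ψ ∈ IsManifold.maximalAtlas (𝓡 n) ∞ M) (hy : y ∈ ψ.target) {f : M → ℝ}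
    (hf : MDifferentiableAt (𝓡 n) 𝓘(ℝ, ℝ) f (ψ.symm y)) (i : Fin n) :
    partialDeriv i (f ∘ ψ.symm) y ^ 2 ≤ ‖grad n f (ψ.symm y)‖ ^ 2 * metricMatrix ψ y i i := by
  rw [← mfderiv_coordVector hψ hy hf, ← inner_grad]
  have := abs_real_inner_le_norm (grad n f (ψ.symm y)) (coordVector ψ i y)
  have h2 : metricMatrix ψ y i i = ‖coordVector ψ i y‖ ^ 2 := by
    simp [metricMatrix]
  rw [h2, ← mul_pow]
  exact sq_le_sq.2 (this.trans (le_abs_self _))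

lemma norm_grad_sq
    (hψ : ψ ∈ IsManifold.maximalAtlas (𝓡 n) ∞ M) (hy : y ∈ ψ.target) {f : M → ℝ}
    (hf : MDifferentiableAt (𝓡 n) 𝓘(ℝ, ℝ) f (ψ.symm y)) :
    ‖grad n f (ψ.symm y)‖ ^ 2 = ∑ i, ∑ j, (metricMatrix ψ y)⁻¹ i j *
      partialDeriv i (f ∘ ψ.symm) y * partialDeriv j (f ∘ ψ.symm) y := by
  have hli := linearIndependent_coordVector hψ hy
  have hdim : Module.finrank ℝ (TangentSpace (𝓡 n) (ψ.symm y)) = n :=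
    finrank_euclideanSpace_fin (𝕜 := ℝ) (n := n)
  have : FiniteDimensional ℝ (TangentSpace (𝓡 n) (ψ.symm y)) :=
    inferInstanceAs (FiniteDimensional ℝ (EuclideanSpace ℝ (Fin n)))
  let B : Module.Basis (Fin n) ℝ (TangentSpace (𝓡 n) (ψ.symm y)) := Module.Basis.mk hli
    (hli.span_eq_top_of_card_eq_finrank' (by simp [hdim])).ge
  have hB : ∀ i, B i = coordVector ψ i y := fun i ↦ by simp [B]
  set v := grad n f (ψ.symm y)
  set p : Fin n → ℝ := fun i ↦ partialDeriv i (f ∘ ψ.symm) y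
  set c : Fin n → ℝ := fun i ↦ B.repr v i
  have hv : v = ∑ i, c i • coordVector ψ i y := by
    rw [← B.sum_repr v]; simp [hB, c]
  have hp : ∀ i, inner ℝ v (coordVector ψ i y) = p i := fun i ↦ by
    rw [inner_grad, mfderiv_coordVector hψ hy hf]
  -- The components `c` of the gradient are obtained from the partial derivatives `p` by inverting
  -- the Gram matrix, and `‖v‖² = c · p`.
  have hgc : (metricMatrix ψ y).mulVec c = p := by
    ext i
    rw [← hp, hv, sum_inner, Matrix.mulVec, dotProduct]
    refine Finset.sum_congr rfl fun j _ ↦ ?_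
    rw [real_inner_smul_left, real_inner_comm, mul_comm]
    rfl
  have hdet : IsUnit (metricMatrix ψ y).det := (metricMatrix_posDef hψ hy).det_pos.ne'.isUnit
  have hc : c = (metricMatrix ψ y)⁻¹.mulVec p := by
    rw [← hgc, Matrix.mulVec_mulVec, Matrix.nonsing_inv_mul _ hdet, Matrix.one_mulVec]
  have h1 : ‖v‖ ^ 2 = ∑ i, c i * p i := by
    rw [← real_inner_self_eq_norm_sq]
    conv_lhs => rw [hv]
    rw [sum_inner]
    refine Finset.sum_congr rfl fun i _ ↦ ?_
    rw [real_inner_smul_left, real_inner_comm, ← hv, hp]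
  rw [h1, hc]
  simp only [Matrix.mulVec, dotProduct, Finset.sum_mul]
  exact Finset.sum_congr rfl fun i _ ↦ Finset.sum_congr rfl fun j _ ↦ by ring

variable [IsContMDiffRiemannianBundle (𝓡 n) ∞ (EuclideanSpace ℝ (Fin n))
      (fun x : M ↦ TangentSpace (𝓡 n) x)]

/-- The coordinate fields are images of constant fields under the tangent map of `ψ.symm`, so they
are smooth, and the metric is smooth on smooth fields. -/
lemma contDiffOn_metricMatrix
    (hψ : ψ ∈ IsManifold.maximalAtlas (𝓡 n) ∞ M) (i j : Fin n) :
    ContDiffOn ℝ ∞ (fun y ↦ metricMatrix ψ y i j) ψ.target := by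
  have key : ∀ i, ContMDiffOn (𝓡 n) ((𝓡 n).prod 𝓘(ℝ, EuclideanSpace ℝ (Fin n))) ∞
      (fun y ↦ (⟨ψ.symm y, coordVector ψ i y⟩ : TangentBundle (𝓡 n) M)) ψ.target := by
    intro i
    have h1 := (contMDiffOn_symm_of_mem_maximalAtlas hψ).contMDiffOn_tangentMapWithin (m := ∞)
      (by simp) ψ.open_target.uniqueMDiffOn
    have h2 : ContMDiffOn (𝓡 n) ((𝓡 n).prod 𝓘(ℝ, EuclideanSpace ℝ (Fin n))) ∞
        (fun y ↦ (⟨y, EuclideanSpace.single i (1 : ℝ)⟩ :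
          TangentBundle (𝓡 n) (EuclideanSpace ℝ (Fin n)))) ψ.target := by
      exact contMDiffOn_vectorSpace_iff_contDiffOn.2 contDiffOn_const
    refine (h1.comp h2 (fun y hy ↦ hy)).congr fun y hy ↦ ?_
    simp only [Function.comp, tangentMapWithin, coordVector]
    rw [mfderivWithin_of_isOpen ψ.open_target hy]
  rw [← contMDiffOn_iff_contDiffOn]
  exact ContMDiffOn.inner_bundle (IB := 𝓡 n) (F := EuclideanSpace ℝ (Fin n))
    (E := fun x : M ↦ TangentSpace (𝓡 n) x) (key i) (key j)

end Metric

section Smooth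

variable {E : Type*} [NormedAddCommGroup E] [NormedSpace ℝ E] {n : ℕ} {k : WithTop ℕ∞}

lemma contDiffAt_det {A : E → Matrix (Fin n) (Fin n) ℝ} {y : E}
    (hA : ∀ i j, ContDiffAt ℝ k (fun y ↦ A y i j) y) : ContDiffAt ℝ k (fun y ↦ (A y).det) y := by
  simp only [Matrix.det_apply]
  refine ContDiffAt.sum fun σ _ ↦ ContDiffAt.const_smul _ ?_
  exact contDiffAt_prod fun i _ ↦ hA _ _

lemma contDiffAt_inv_matrix {A : E → Matrix (Fin n) (Fin n) ℝ} {y : E}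
    (hA : ∀ i j, ContDiffAt ℝ k (fun y ↦ A y i j) y) (hy : (A y).det ≠ 0) (i j : Fin n) :
    ContDiffAt ℝ k (fun y ↦ (A y)⁻¹ i j) y := by
  simp only [Matrix.inv_def, Ring.inverse_eq_inv', Matrix.smul_apply, smul_eq_mul,
    Matrix.adjugate_apply]
  refine ((contDiffAt_det hA).inv hy).mul (contDiffAt_det fun a b ↦ ?_)
  simp only [Matrix.updateRow_apply]
  split_ifs
  · exact contDiffAt_const
  · exact hA a b

lemma contDiffAt_partialDeriv {h : EuclideanSpace ℝ (Fin n) → ℝ} {y : EuclideanSpace ℝ (Fin n)}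
    {m : WithTop ℕ∞} (hh : ContDiffAt ℝ k h y) (hm : m + 1 ≤ k) (i : Fin n) :
    ContDiffAt ℝ m (partialDeriv i h) y :=
  (hh.fderiv_right hm).clm_apply contDiffAt_const

lemma fderiv_eq_sum_partialDeriv (h : EuclideanSpace ℝ (Fin n) → ℝ)
    (y v : EuclideanSpace ℝ (Fin n)) : fderiv ℝ h y v = ∑ i, v i * partialDeriv i h y := by
  have : v = ∑ i, v i • EuclideanSpace.single i (1 : ℝ) := by
    ext j; simp [Finset.sum_apply, Pi.single_apply]
  conv_lhs => rw [this]
  simp [partialDeriv]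

end Smooth

/-! ### The Laplacian of a composition and at a critical point. -/

section Laplacian

variable {n : ℕ} {M : Type*} [TopologicalSpace M] [ChartedSpace (EuclideanSpace ℝ (Fin n)) M]
  {ψ : OpenPartialHomeomorph M (EuclideanSpace ℝ (Fin n))}
  {y : EuclideanSpace ℝ (Fin n)}

lemma contDiffAt_comp_symm (hψ : ψ ∈ IsManifold.maximalAtlas (𝓡 n) ∞ M) (hy : y ∈ ψ.target)
    {f : M → ℝ} {k : WithTop ℕ∞} (hk : k ≤ ∞) (hf : ContMDiffAt (𝓡 n) 𝓘(ℝ, ℝ) k f (ψ.symm y)) :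
    ContDiffAt ℝ k (f ∘ ψ.symm) y := by
  rw [← contMDiffAt_iff_contDiffAt]
  exact hf.comp y ((contMDiffAt_symm_of_mem_maximalAtlas hψ hy).of_le hk)

variable [IsManifold (𝓡 n) ∞ M] [RiemannianBundle (fun x : M ↦ TangentSpace (𝓡 n) x)]
  [IsContMDiffRiemannianBundle (𝓡 n) ∞ (EuclideanSpace ℝ (Fin n))
      (fun x : M ↦ TangentSpace (𝓡 n) x)]

lemma contDiffAt_metricMatrix (hψ : ψ ∈ IsManifold.maximalAtlas (𝓡 n) ∞ M) (hy : y ∈ ψ.target)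
    (i j : Fin n) : ContDiffAt ℝ ∞ (fun y ↦ metricMatrix ψ y i j) y :=
  (contDiffOn_metricMatrix hψ i j).contDiffAt (ψ.open_target.mem_nhds hy)

lemma contDiffAt_inv_metricMatrix (hψ : ψ ∈ IsManifold.maximalAtlas (𝓡 n) ∞ M)
    (hy : y ∈ ψ.target) (i j : Fin n) : ContDiffAt ℝ ∞ (fun y ↦ (metricMatrix ψ y)⁻¹ i j) y :=
  contDiffAt_inv_matrix (contDiffAt_metricMatrix hψ hy) (metricMatrix_posDef hψ hy).det_pos.ne' i j

lemma contDiffAt_sqrt_det (hψ : ψ ∈ IsManifold.maximalAtlas (𝓡 n) ∞ M) (hy : y ∈ ψ.target) :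
    ContDiffAt ℝ ∞ (fun y ↦ Real.sqrt (metricMatrix ψ y).det) y :=
  (contDiffAt_det (contDiffAt_metricMatrix hψ hy)).sqrt (metricMatrix_posDef hψ hy).det_pos.ne'

/-- This reduces the PDE for `φ ∘ f` to an ODE for `φ`. -/
lemma laplacian_comp {f : M → ℝ} (hf : ContMDiff (𝓡 n) 𝓘(ℝ, ℝ) ∞ f) {φ : ℝ → ℝ} {x : M}
    (hφ : ContDiffAt ℝ 2 φ (f x)) :
    laplacian n (φ ∘ f) x =
      -(deriv (deriv φ) (f x) * ‖grad n f x‖ ^ 2) + deriv φ (f x) * laplacian n f x := by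
  set ψ := chartAt (EuclideanSpace ℝ (Fin n)) x with hψdef
  have hψ : ψ ∈ IsManifold.maximalAtlas (𝓡 n) ∞ M := IsManifold.chart_mem_maximalAtlas x
  have hxs : x ∈ ψ.source := mem_chart_source _ x
  have hy : ψ x ∈ ψ.target := ψ.map_source hxs
  have hsx : ψ.symm (ψ x) = x := ψ.left_inv hxs
  set F : EuclideanSpace ℝ (Fin n) → ℝ := f ∘ ψ.symm with hF
  have hFx : F (ψ x) = f x := by simp [hF, hsx]
  have hFs : ContDiffAt ℝ ∞ F (ψ x) := contDiffAt_comp_symm hψ hy le_rfl (hf _)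
  set G : EuclideanSpace ℝ (Fin n) → ℝ := fun y ↦ Real.sqrt (metricMatrix ψ y).det with hG
  have hGpos : 0 < G (ψ x) := Real.sqrt_pos.2 (metricMatrix_posDef hψ hy).det_pos
  set X : Fin n → EuclideanSpace ℝ (Fin n) → ℝ := fun i y ↦
    ∑ j, (metricMatrix ψ y)⁻¹ i j * partialDeriv j F y with hX
  have hGX : ∀ i, DifferentiableAt ℝ (fun y ↦ G y * X i y) (ψ x) := by
    intro i
    refine ContDiffAt.differentiableAt (n := ∞) ?_ (by simp)
    exact (contDiffAt_sqrt_det hψ hy).mul (ContDiffAt.sum fun j _ ↦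
      (contDiffAt_inv_metricMatrix hψ hy i j).mul (contDiffAt_partialDeriv hFs (by simp) j))
  have hcomp : ∀ᶠ y in 𝓝 (ψ x), ∀ j,
      partialDeriv j ((φ ∘ f) ∘ ψ.symm) y = deriv φ (F y) * partialDeriv j F y := by
    have h1 : ∀ᶠ y in 𝓝 (ψ x), ContDiffAt ℝ 2 φ (F y) := by
      have := (hFx ▸ hφ).eventually (by simp)
      exact hFs.continuousAt.eventually this
    filter_upwards [h1, (hFs.of_le (m := 1) (by simp)).eventually (by simp)] with y h1 h2 j
    have := (h1.differentiableAt (by simp)).hasDerivAt.comp_hasFDerivAt y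
      (h2.differentiableAt (by simp)).hasFDerivAt
    have h3 : (φ ∘ f) ∘ ψ.symm = φ ∘ F := rfl
    rw [partialDeriv, h3, this.fderiv]
    simp [partialDeriv]
  have hd : HasFDerivAt (fun y ↦ deriv φ (F y))
      (deriv (deriv φ) (F (ψ x)) • fderiv ℝ F (ψ x)) (ψ x) := by
    have h1 : DifferentiableAt ℝ (deriv φ) (F (ψ x)) := by
      rw [hFx]
      have : ContDiffAt ℝ 1 (deriv φ) (f x) := hφ.derivWithin (by norm_num)
      exact this.differentiableAt (by simp)
    exact h1.hasDerivAt.comp_hasFDerivAt (ψ x) (hFs.differentiableAt (by simp)).hasFDerivAt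
  have hpd : ∀ i, partialDeriv i (fun y ↦ G y * ∑ j, (metricMatrix ψ y)⁻¹ i j *
      partialDeriv j ((φ ∘ f) ∘ ψ.symm) y) (ψ x) =
      deriv φ (f x) * partialDeriv i (fun y ↦ G y * X i y) (ψ x) +
        deriv (deriv φ) (f x) * (G (ψ x) * (X i (ψ x) * partialDeriv i F (ψ x))) := by
    intro i
    have heq : (fun y ↦ G y * ∑ j, (metricMatrix ψ y)⁻¹ i j *
      partialDeriv j ((φ ∘ f) ∘ ψ.symm) y) =ᶠ[𝓝 (ψ x)]
        fun y ↦ deriv φ (F y) * (G y * X i y) := by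
      filter_upwards [hcomp] with y hy
      simp only [hy, hX, Finset.mul_sum]
      exact Finset.sum_congr rfl fun j _ ↦ by ring
    rw [partialDeriv, heq.fderiv_eq, (hd.fun_mul (hGX i).hasFDerivAt).fderiv]
    simp only [_root_.add_apply, _root_.smul_apply, smul_eq_mul, hFx,
      partialDeriv]
    ring
  have hgrad : ‖grad n f x‖ ^ 2 = ∑ i, X i (ψ x) * partialDeriv i F (ψ x) := by
    have := norm_grad_sq hψ hy ((hf (ψ.symm (ψ x))).mdifferentiableAt (by simp))
    rw [hsx] at this
    rw [this]
    simp only [hX, Finset.sum_mul]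
    exact Finset.sum_congr rfl fun i _ ↦ Finset.sum_congr rfl fun j _ ↦ by ring
  have hl : laplacian n f x =
      (-1) * (1 / G (ψ x)) * ∑ i, partialDeriv i (fun y ↦ G y * X i y) (ψ x) := rfl
  have hl' : laplacian n (φ ∘ f) x = (-1) * (1 / G (ψ x)) * ∑ i, partialDeriv i
      (fun y ↦ G y * ∑ j, (metricMatrix ψ y)⁻¹ i j *
        partialDeriv j ((φ ∘ f) ∘ ψ.symm) y) (ψ x) := rfl
  rw [hl', hl, hgrad]
  simp only [hpd, Finset.sum_add_distrib, ← Finset.mul_sum]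
  field_simp
  ring

/-- Every term that differentiates the metric carries a first derivative of `f`, so only the trace
of the Hessian survives. -/
lemma laplacian_of_partialDeriv_eq_zero {f : M → ℝ} (hf : ContMDiff (𝓡 n) 𝓘(ℝ, ℝ) ∞ f) {x : M}
    {ψ : OpenPartialHomeomorph M (EuclideanSpace ℝ (Fin n))}
    (hψx : ψ = chartAt (EuclideanSpace ℝ (Fin n)) x)
    (hx : ∀ i, partialDeriv i (f ∘ ψ.symm) (ψ x) = 0) :
    laplacian n f x = -∑ i, ∑ j, (metricMatrix ψ (ψ x))⁻¹ i j *
      partialDeriv i (partialDeriv j (f ∘ ψ.symm)) (ψ x) := by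
  have hψ : ψ ∈ IsManifold.maximalAtlas (𝓡 n) ∞ M := hψx ▸ IsManifold.chart_mem_maximalAtlas x
  have hxs : x ∈ ψ.source := hψx ▸ mem_chart_source _ x
  have hy : ψ x ∈ ψ.target := ψ.map_source hxs
  set F : EuclideanSpace ℝ (Fin n) → ℝ := f ∘ ψ.symm with hF
  have hFs : ContDiffAt ℝ ∞ F (ψ x) := contDiffAt_comp_symm hψ hy le_rfl (hf _)
  set G : EuclideanSpace ℝ (Fin n) → ℝ := fun y ↦ Real.sqrt (metricMatrix ψ y).det with hG
  have hGpos : 0 < G (ψ x) := Real.sqrt_pos.2 (metricMatrix_posDef hψ hy).det_pos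
  have hl : laplacian n f x =
      (-1) * (1 / G (ψ x)) * ∑ i, partialDeriv i (fun y ↦ G y * ∑ j, (metricMatrix ψ y)⁻¹ i j *
        partialDeriv j F y) (ψ x) := by
    subst hψx; rfl
  have hpd : ∀ i, partialDeriv i (fun y ↦ G y * ∑ j, (metricMatrix ψ y)⁻¹ i j *
      partialDeriv j F y) (ψ x) = G (ψ x) * ∑ j, (metricMatrix ψ (ψ x))⁻¹ i j *
        partialDeriv i (partialDeriv j F) (ψ x) := by
    intro i
    have h1 : HasFDerivAt G (fderiv ℝ G (ψ x)) (ψ x) :=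
      ((contDiffAt_sqrt_det hψ hy).differentiableAt (by simp)).hasFDerivAt
    have h2 : ∀ j, HasFDerivAt (fun y ↦ (metricMatrix ψ y)⁻¹ i j * partialDeriv j F y) _ (ψ x) :=
      fun j ↦ ((contDiffAt_inv_metricMatrix hψ hy i j).differentiableAt (by simp)).hasFDerivAt.mul
        ((contDiffAt_partialDeriv hFs (m := ∞) (by simp) j).differentiableAt
          (by simp)).hasFDerivAt
    have h3 := h1.fun_mul (HasFDerivAt.fun_sum (u := Finset.univ) fun j _ ↦ h2 j)
    rw [partialDeriv, h3.fderiv]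
    have hx' : ∀ i, fderiv ℝ F (ψ x) (EuclideanSpace.single i 1) = 0 := hx
    simp [hx', partialDeriv]
  rw [hl]
  simp only [hpd, ← Finset.mul_sum]
  field_simp

end Laplacian

/-! ### Gradient bounds and local constancy. -/

section Transnormal

variable {n : ℕ} {M : Type*} [TopologicalSpace M] [ChartedSpace (EuclideanSpace ℝ (Fin n)) M]
  [IsManifold (𝓡 n) ∞ M] [RiemannianBundle (fun x : M ↦ TangentSpace (𝓡 n) x)]
  [IsContMDiffRiemannianBundle (𝓡 n) ∞ (EuclideanSpace ℝ (Fin n))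
      (fun x : M ↦ TangentSpace (𝓡 n) x)]

lemma exists_norm_fderiv_le_norm_grad {f : M → ℝ} (hf : ContMDiff (𝓡 n) 𝓘(ℝ, ℝ) ∞ f)
    {ψ : OpenPartialHomeomorph M (EuclideanSpace ℝ (Fin n))}
    (hψ : ψ ∈ IsManifold.maximalAtlas (𝓡 n) ∞ M) {y₀ : EuclideanSpace ℝ (Fin n)}
    (hy₀ : y₀ ∈ ψ.target) :
    ∃ C > 0, ∀ᶠ y in 𝓝 y₀, ‖fderiv ℝ (f ∘ ψ.symm) y‖ ≤ C * ‖grad n f (ψ.symm y)‖ := by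
  have hcont : ContinuousAt (fun y ↦ ∑ i, Real.sqrt (metricMatrix ψ y i i)) y₀ :=
    tendsto_finsetSum _ fun i _ ↦
      (Real.continuous_sqrt.continuousAt.comp (contDiffAt_metricMatrix hψ hy₀ i i).continuousAt)
  have hev := hcont.eventually (gt_mem_nhds (lt_add_one _))
  set C := ∑ i, Real.sqrt (metricMatrix ψ y₀ i i) + 1
  have hC : 0 < C := by positivity
  refine ⟨C, hC, ?_⟩
  filter_upwards [hev, ψ.open_target.mem_nhds hy₀] with y hy hyt
  refine ContinuousLinearMap.opNorm_le_bound _ (by positivity) fun v ↦ ?_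
  rw [fderiv_eq_sum_partialDeriv, Real.norm_eq_abs]
  have hi : ∀ i, |v i * partialDeriv i (f ∘ ψ.symm) y| ≤
      Real.sqrt (metricMatrix ψ y i i) * (‖grad n f (ψ.symm y)‖ * ‖v‖) := by
    intro i
    have h1 : |v i| ≤ ‖v‖ := PiLp.norm_apply_le v i
    have h2 := partialDeriv_sq_le hψ hyt ((hf (ψ.symm y)).mdifferentiableAt (by simp)) i
    have h3 := Real.abs_le_sqrt h2
    rw [Real.sqrt_mul (by positivity), Real.sqrt_sq (norm_nonneg _)] at h3
    rw [abs_mul]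
    calc _ ≤ ‖v‖ * (‖grad n f (ψ.symm y)‖ * √(metricMatrix ψ y i i)) := by gcongr
      _ = _ := by ring
  calc _ ≤ ∑ i, |v i * partialDeriv i (f ∘ ψ.symm) y| := Finset.abs_sum_le_sum_abs _ _
    _ ≤ ∑ i, Real.sqrt (metricMatrix ψ y i i) * (‖grad n f (ψ.symm y)‖ * ‖v‖) :=
      Finset.sum_le_sum fun i _ ↦ hi i
    _ = (∑ i, Real.sqrt (metricMatrix ψ y i i)) * (‖grad n f (ψ.symm y)‖ * ‖v‖) := by
      rw [Finset.sum_mul]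
    _ ≤ C * (‖grad n f (ψ.symm y)‖ * ‖v‖) := by gcongr
    _ = _ := by ring

/-- A function whose gradient is controlled by its distance to the value `c` is locally constant
where it takes the value `c`. -/
lemma eventually_eq_of_norm_grad_le {f : M → ℝ} (hf : ContMDiff (𝓡 n) 𝓘(ℝ, ℝ) ∞ f) {x₀ : M}
    {C : ℝ} (h : ∀ᶠ x in 𝓝 x₀, ‖grad n f x‖ ≤ C * |f x - f x₀|) :
    ∀ᶠ x in 𝓝 x₀, f x = f x₀ := by
  set ψ := chartAt (EuclideanSpace ℝ (Fin n)) x₀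
  have hψ : ψ ∈ IsManifold.maximalAtlas (𝓡 n) ∞ M := IsManifold.chart_mem_maximalAtlas x₀
  have hxs : x₀ ∈ ψ.source := mem_chart_source _ x₀
  have hy : ψ x₀ ∈ ψ.target := ψ.map_source hxs
  have hsx : ψ.symm (ψ x₀) = x₀ := ψ.left_inv hxs
  obtain ⟨D, hD, hD'⟩ := exists_norm_fderiv_le_norm_grad hf hψ hy
  have hc : ContinuousAt ψ.symm (ψ x₀) := ψ.continuousAt_symm hy
  have h' : ∀ᶠ y in 𝓝 (ψ x₀), ‖grad n f (ψ.symm y)‖ ≤ C * |f (ψ.symm y) - f x₀| :=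
    hc.eventually (by rwa [hsx])
  obtain ⟨r, hr, hball⟩ := Metric.eventually_nhds_iff_ball.1
    ((hD'.and h').and (ψ.open_target.mem_nhds hy))
  set F := f ∘ ψ.symm with hF
  have key : ∀ y ∈ Metric.ball (ψ x₀) r, F y = f x₀ := by
    intro y hyr
    set v := y - ψ x₀
    have hmem : ∀ t ∈ Icc (0 : ℝ) 1, ψ x₀ + t • v ∈ Metric.ball (ψ x₀) r := by
      intro t ht
      rw [mem_ball_iff_norm] at hyr ⊢
      rw [add_sub_cancel_left, norm_smul, Real.norm_of_nonneg ht.1]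
      exact (mul_le_of_le_one_left (norm_nonneg _) ht.2).trans_lt hyr
    have hder : ∀ t ∈ Icc (0 : ℝ) 1, HasDerivAt (fun t : ℝ ↦ F (ψ x₀ + t • v) - f x₀)
        (fderiv ℝ F (ψ x₀ + t • v) v) t := by
      intro t ht
      have h1 : HasDerivAt (fun t : ℝ ↦ ψ x₀ + t • v) v t := by
        simpa using ((hasDerivAt_id t).smul_const v).const_add (ψ x₀)
      have h2 : ContDiffAt ℝ ∞ F (ψ x₀ + t • v) :=
        contDiffAt_comp_symm hψ (hball _ (hmem t ht)).2 le_rfl (hf _)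
      exact ((h2.differentiableAt (by simp)).hasFDerivAt.comp_hasDerivAt t h1).sub_const _
    -- Grönwall along the segment from `ψ x₀` to `y`, on which `F - f x₀` starts at zero.
    have := eq_zero_of_abs_deriv_le_mul_abs_self_of_eq_zero_right
      (f := fun t : ℝ ↦ F (ψ x₀ + t • v) - f x₀) (K := D * C * ‖v‖) (a := 0) (b := 1)
      (fun t ht ↦ (hder t ht).continuousAt.continuousWithinAt)
      (fun t ht ↦ (hder t (Ico_subset_Icc_self ht)).hasDerivWithinAt) (by simp [hF, hsx])
      (fun t ht ↦ ?_) 1 (by simp)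
    · simpa [v, sub_eq_zero] using this
    · obtain ⟨⟨h1, h2⟩, -⟩ := hball _ (hmem t (Ico_subset_Icc_self ht))
      calc _ ≤ ‖fderiv ℝ F (ψ x₀ + t • v)‖ * ‖v‖ := ContinuousLinearMap.le_opNorm _ _
        _ ≤ (D * (C * |F (ψ x₀ + t • v) - f x₀|)) * ‖v‖ := by
          gcongr
          exact h1.trans (by gcongr; exact h2)
        _ = D * C * ‖v‖ * |F (ψ x₀ + t • v) - f x₀| := by ring
  filter_upwards [ψ.open_source.mem_nhds hxs, (ψ.continuousAt hxs).eventually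
    (Metric.ball_mem_nhds _ hr)] with x hx hx'
  have := key _ hx'
  rwa [hF, Function.comp, ψ.left_inv hx] at this

/-- On a connected manifold, no level of a non-constant function is one near which the gradient
is controlled by the distance to the level. -/
lemma not_norm_grad_le_near_level [ConnectedSpace M] {f : M → ℝ}
    (hf : ContMDiff (𝓡 n) 𝓘(ℝ, ℝ) ∞ f) (hne : ∃ x y, f x ≠ f y) {x₀ : M} {C : ℝ} {δ : ℝ}
    (hδ : 0 < δ) (h : ∀ x, |f x - f x₀| < δ → ‖grad n f x‖ ≤ C * |f x - f x₀|) : False := by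
  have hclopen : IsClopen {x | f x = f x₀} := by
    refine ⟨isClosed_eq hf.continuous continuous_const, isOpen_iff_mem_nhds.2 fun x hx ↦ ?_⟩
    have hx' : f x = f x₀ := hx
    rw [← hx'] at h
    have : ∀ᶠ z in 𝓝 x, |f z - f x| < δ := by
      have : Continuous fun z ↦ |f z - f x| := (hf.continuous.sub continuous_const).abs
      exact this.continuousAt.eventually (gt_mem_nhds (by simpa using hδ))
    have h2 := eventually_eq_of_norm_grad_le hf (this.mono fun z hz ↦ h z hz)
    rw [hx'] at h2
    exact h2
  have huniv := hclopen.eq_univ ⟨x₀, rfl⟩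
  obtain ⟨x, y, hxy⟩ := hne
  have h1 : x ∈ {x | f x = f x₀} := huniv ▸ mem_univ x
  have h2 : y ∈ {x | f x = f x₀} := huniv ▸ mem_univ y
  exact hxy (h1.trans h2.symm)

end Transnormal

/-- A `C²` function on an interval vanishes to second order where it vanishes to first order. -/
lemma exists_abs_le_mul_sq {b : ℝ → ℝ} {α γ c : ℝ} (hαγ : α < γ)
    (hb : ContDiffOn ℝ ∞ b (Icc α γ)) (hc : c ∈ Icc α γ) (h0 : b c = 0)
    (h1 : derivWithin b (Icc α γ) c = 0) :
    ∃ L, ∀ t ∈ Icc α γ, |b t| ≤ L ^ 2 * (t - c) ^ 2 := by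
  have hu := uniqueDiffOn_Icc hαγ
  have hb' : ContDiffOn ℝ 1 (derivWithin b (Icc α γ)) (Icc α γ) :=
    hb.derivWithin hu (by norm_cast)
  -- Since `b'` is Lipschitz and vanishes at `c`, `|b'| ≤ L |t - c|` between `c` and `t`; the mean
  -- value inequality supplies the second factor.
  obtain ⟨L, hL⟩ := hb'.exists_lipschitzOnWith (by simp) (convex_Icc α γ) isCompact_Icc
  refine ⟨Real.sqrt L, fun t ht ↦ ?_⟩
  rw [Real.sq_sqrt L.coe_nonneg]
  have hsub : uIcc c t ⊆ Icc α γ := ordConnected_Icc.uIcc_subset hc ht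
  have := Convex.norm_image_sub_le_of_norm_hasDerivWithin_le (f := b)
    (f' := derivWithin b (Icc α γ)) (s := uIcc c t) (C := L * |t - c|)
    (fun x hx ↦ ((hb.differentiableOn (by simp) x (hsub hx)).hasDerivWithinAt.mono hsub))
    (fun x hx ↦ ?_) (convex_uIcc c t) left_mem_uIcc right_mem_uIcc
  · rw [h0, sub_zero] at this
    calc _ ≤ L * |t - c| * |t - c| := this
      _ = _ := by rw [mul_assoc, ← abs_mul, ← sq, abs_of_nonneg (sq_nonneg _)]
  · have h2 := hL.dist_le_mul x (hsub hx) c hc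
    rw [Real.dist_eq, Real.dist_eq, h1, sub_zero] at h2
    refine h2.trans ?_
    exact mul_le_mul_of_nonneg_left (abs_sub_left_of_mem_uIcc hx) L.coe_nonneg

/-! ### Extremal levels and the range of `f`. -/

section Levels

variable {M : Type*}

lemma eq_iInf_of_mem_minLevel {f : M → ℝ} {x : M} (hx : x ∈ minLevel f) : f x = ⨅ y, f y :=
  have : Nonempty M := ⟨x⟩
  (le_ciInf hx).antisymm (ciInf_le ⟨f x, forall_mem_range.2 hx⟩ x)

lemma eq_iSup_of_mem_maxLevel {f : M → ℝ} {x : M} (hx : x ∈ maxLevel f) : f x = ⨆ y, f y :=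
  have : Nonempty M := ⟨x⟩
  (le_ciSup (f := f) ⟨f x, forall_mem_range.2 hx⟩ x).antisymm (ciSup_le hx)

variable [TopologicalSpace M]

lemma partialDeriv_eq_zero_of_mem_minLevel {n : ℕ} {f : M → ℝ}
    {ψ : OpenPartialHomeomorph M (EuclideanSpace ℝ (Fin n))} {y : EuclideanSpace ℝ (Fin n)}
    (hx : ψ.symm y ∈ minLevel f) (i : Fin n) : partialDeriv i (f ∘ ψ.symm) y = 0 := by
  have : IsLocalMin (f ∘ ψ.symm) y := Eventually.of_forall fun z ↦ hx _
  rw [partialDeriv, this.fderiv_eq_zero]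
  rfl

variable [CompactSpace M] [ConnectedSpace M] {f : M → ℝ}

lemma range_eq_Icc (hf : Continuous f) : range f = Icc (⨅ x, f x) (⨆ x, f x) :=
  eq_Icc_of_connected_compact ⟨range_nonempty f, isPreconnected_range hf⟩ (isCompact_range hf)

lemma mem_minLevel_iff (hf : Continuous f) {x : M} : x ∈ minLevel f ↔ f x = ⨅ y, f y :=
  ⟨eq_iInf_of_mem_minLevel, fun h y ↦ h ▸ (range_eq_Icc hf ▸ mem_range_self y :
    f y ∈ Icc (⨅ x, f x) (⨆ x, f x)).1⟩

lemma mem_maxLevel_iff (hf : Continuous f) {x : M} : x ∈ maxLevel f ↔ f x = ⨆ y, f y :=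
  ⟨eq_iSup_of_mem_maxLevel, fun h y ↦ h ▸ (range_eq_Icc hf ▸ mem_range_self y :
    f y ∈ Icc (⨅ x, f x) (⨆ x, f x)).2⟩

lemma notMem_focalSet_iff (hf : Continuous f) {x : M} :
    x ∈ (focalSet f)ᶜ ↔ f x ∈ Ioo (⨅ x, f x) (⨆ x, f x) := by
  have h : f x ∈ Icc (⨅ x, f x) (⨆ x, f x) := range_eq_Icc hf ▸ mem_range_self x
  rw [focalSet, mem_compl_iff, mem_union, mem_minLevel_iff hf, mem_maxLevel_iff hf, not_or]
  exact ⟨fun ⟨h1, h2⟩ ↦ ⟨h.1.lt_of_ne (Ne.symm h1), h.2.lt_of_ne h2⟩,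
    fun ⟨h1, h2⟩ ↦ ⟨h1.ne', h2.ne⟩⟩

lemma iInf_lt_iSup (hf : Continuous f) (hne : ∃ x y, f x ≠ f y) :
    ⨅ x, f x < ⨆ x, f x := by
  obtain ⟨x, y, hxy⟩ := hne
  have h := range_eq_Icc hf
  have hx : f x ∈ Icc (⨅ x, f x) (⨆ x, f x) := h ▸ mem_range_self x
  have hy : f y ∈ Icc (⨅ x, f x) (⨆ x, f x) := h ▸ mem_range_self y
  by_contra hlt
  exact hxy (by linarith [hx.1, hx.2, hy.1, hy.2])

end Levels

/-! ### Zeros of the profile `b` of `|∇f|²`. -/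

section GradientProfile

variable {n : ℕ} {M : Type*} [TopologicalSpace M] [CompactSpace M] [ConnectedSpace M]
  [ChartedSpace (EuclideanSpace ℝ (Fin n)) M]
  [IsManifold (𝓡 n) ∞ M] [RiemannianBundle (fun x : M ↦ TangentSpace (𝓡 n) x)]

lemma profile_iInf_eq_zero
    {f : M → ℝ} (hf : ContMDiff (𝓡 n) 𝓘(ℝ, ℝ) ∞ f) (hne : ∃ x y, f x ≠ f y) {b : ℝ → ℝ}
    (hgrad : ∀ x, ‖grad n f x‖ ^ 2 = b (f x)) :
    b (⨅ x, f x) = 0 := by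
  obtain ⟨x, hx⟩ : (⨅ x, f x) ∈ range f :=
    range_eq_Icc hf.continuous ▸ left_mem_Icc.2 (iInf_lt_iSup hf.continuous hne).le
  set ψ := chartAt (EuclideanSpace ℝ (Fin n)) x
  have hxs : x ∈ ψ.source := mem_chart_source _ x
  have h := norm_grad_sq (IsManifold.chart_mem_maximalAtlas x) (ψ.map_source hxs)
    ((hf _).mdifferentiableAt (by simp))
  rw [ψ.left_inv hxs, hgrad, hx] at h
  rw [h]
  have h0 : ∀ i, partialDeriv i (f ∘ ψ.symm) (ψ x) = 0 := fun i ↦ by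
    refine partialDeriv_eq_zero_of_mem_minLevel ?_ i
    rwa [ψ.left_inv hxs, mem_minLevel_iff hf.continuous]
  exact Finset.sum_eq_zero fun i _ ↦ Finset.sum_eq_zero fun j _ ↦ by simp [ψ, h0]

variable [IsContMDiffRiemannianBundle (𝓡 n) ∞ (EuclideanSpace ℝ (Fin n))
      (fun x : M ↦ TangentSpace (𝓡 n) x)]

/-- At a double zero `c` of `b`, `|∇f| ≤ |L| |f - c|`, which `not_norm_grad_le_near_level` excludes.
-/
lemma derivWithin_ne_zero_of_eq_zero
    {f : M → ℝ} (hf : ContMDiff (𝓡 n) 𝓘(ℝ, ℝ) ∞ f) (hne : ∃ x y, f x ≠ f y) {b : ℝ → ℝ}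
    (hb : ContDiffOn ℝ ∞ b (Icc (⨅ x, f x) (⨆ x, f x)))
    (hgrad : ∀ x, ‖grad n f x‖ ^ 2 = b (f x))
    {c : ℝ} (hc : c ∈ Icc (⨅ x, f x) (⨆ x, f x)) (h0 : b c = 0) :
    derivWithin b (Icc (⨅ x, f x) (⨆ x, f x)) c ≠ 0 := by
  intro h1
  have hr := range_eq_Icc hf.continuous
  obtain ⟨L, hL⟩ := exists_abs_le_mul_sq (iInf_lt_iSup hf.continuous hne) hb hc h0 h1
  obtain ⟨x₀, rfl⟩ : c ∈ range f := hr ▸ hc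
  refine not_norm_grad_le_near_level hf hne (x₀ := x₀) (C := |L|) one_pos fun x _ ↦ ?_
  have := hL (f x) (hr ▸ mem_range_self x)
  rw [← hgrad, abs_of_nonneg (by positivity), ← mul_pow] at this
  rw [← abs_mul]
  simpa using sq_le_sq.1 this

/-- An interior zero of `b ≥ 0` would be a local minimum, hence a double zero. -/
lemma profile_pos
    {f : M → ℝ} (hf : ContMDiff (𝓡 n) 𝓘(ℝ, ℝ) ∞ f) (hne : ∃ x y, f x ≠ f y) {b : ℝ → ℝ}
    (hb : ContDiffOn ℝ ∞ b (Icc (⨅ x, f x) (⨆ x, f x)))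
    (hgrad : ∀ x, ‖grad n f x‖ ^ 2 = b (f x))
    {c : ℝ} (hc : c ∈ Ioo (⨅ x, f x) (⨆ x, f x)) : 0 < b c := by
  have hr := range_eq_Icc hf.continuous
  have hnn : ∀ t ∈ Icc (⨅ x, f x) (⨆ x, f x), 0 ≤ b t := by
    intro t ht
    obtain ⟨x, rfl⟩ : t ∈ range f := hr ▸ ht
    rw [← hgrad]; positivity
  refine (hnn c (Ioo_subset_Icc_self hc)).lt_of_ne fun h0 ↦ ?_
  refine derivWithin_ne_zero_of_eq_zero hf hne hb hgrad (Ioo_subset_Icc_self hc) h0.symm ?_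
  have hmem : Icc (⨅ x, f x) (⨆ x, f x) ∈ 𝓝 c := Icc_mem_nhds hc.1 hc.2
  rw [derivWithin_of_mem_nhds hmem]
  have : IsLocalMin b c := by
    filter_upwards [hmem] with t ht
    rw [← h0]
    exact hnn t ht
  exact this.deriv_eq_zero

end GradientProfile

/-! ### A trace bound from a quadratic matrix identity. -/

section LinearAlgebra

lemma eq_of_dotProduct_mulVec_eq {n : ℕ} {A B : Matrix (Fin n) (Fin n) ℝ} (hA : A.transpose = A)
    (hB : B.transpose = B) (h : ∀ w, w ⬝ᵥ A.mulVec w = w ⬝ᵥ B.mulVec w) : A = B := by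
  ext i j
  have hA' : A j i = A i j := congrFun (congrFun hA i) j
  have hB' : B j i = B i j := congrFun (congrFun hB i) j
  have h1 := h (Pi.single i 1 + Pi.single j 1)
  have h2 := h (Pi.single i 1)
  have h3 := h (Pi.single j 1)
  simp only [Matrix.mulVec_add, Matrix.mulVec_single_one, add_dotProduct, dotProduct_add,
    single_one_dotProduct, Matrix.col_apply] at h1 h2 h3
  linarith

/-- By polarization the hypothesis says `H A H = c H`, so `c⁻¹ A H` is idempotent and its trace is
its rank. Its kernel lies in that of `H`, so the rank is at least two. -/
lemma two_mul_le_trace {n : ℕ} {A H : Matrix (Fin n) (Fin n) ℝ} {c : ℝ} (hc : 0 < c)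
    (hA : A.transpose = A) (hH : H.transpose = H)
    (h : ∀ w, H.mulVec w ⬝ᵥ A.mulVec (H.mulVec w) = c * (w ⬝ᵥ H.mulVec w))
    (hker : Module.finrank ℝ (LinearMap.ker (Matrix.toLin' H)) + 2 ≤ n) :
    2 * c ≤ (A * H).trace := by
  have hHAH : H * A * H = c • H := by
    refine eq_of_dotProduct_mulVec_eq ?_ ?_ fun w ↦ ?_
    · simp [Matrix.transpose_mul, hA, hH, Matrix.mul_assoc]
    · simp [hH]
    · rw [Matrix.smul_mulVec, dotProduct_smul, smul_eq_mul, ← h, ← Matrix.mulVec_mulVec,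
        ← Matrix.mulVec_mulVec, Matrix.dotProduct_mulVec w H, ← Matrix.mulVec_transpose, hH]
  set P : Matrix (Fin n) (Fin n) ℝ := c⁻¹ • (A * H) with hP
  have hPP : P * P = P := by
    rw [hP, Matrix.smul_mul, Matrix.mul_smul, Matrix.mul_assoc, ← Matrix.mul_assoc H, hHAH,
      Matrix.mul_smul, smul_smul c⁻¹ c, inv_mul_cancel₀ hc.ne', one_smul]
  have hid : IsIdempotentElem (Matrix.toLin' P) := by
    rw [IsIdempotentElem, Module.End.mul_eq_comp, ← Matrix.toLin'_mul, hPP]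
  have htr := (LinearMap.IsIdempotentElem.isProj_range _ hid).trace
  rw [Matrix.trace_toLin'_eq] at htr
  have hkk : LinearMap.ker (Matrix.toLin' P) ≤ LinearMap.ker (Matrix.toLin' H) := by
    intro w hw
    simp only [LinearMap.mem_ker, Matrix.toLin'_apply, hP, Matrix.smul_mulVec, smul_eq_zero,
      inv_eq_zero, hc.ne', false_or] at hw ⊢
    have : (H * A * H).mulVec w = 0 := by
      rw [Matrix.mul_assoc, ← Matrix.mulVec_mulVec, hw, Matrix.mulVec_zero]
    rw [hHAH, Matrix.smul_mulVec] at this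
    exact (smul_eq_zero.1 this).resolve_left hc.ne'
  have h1 := LinearMap.finrank_range_add_finrank_ker (Matrix.toLin' P)
  have h2 := Submodule.finrank_mono hkk
  rw [Module.finrank_fin_fun] at h1
  have h3 : 2 ≤ Module.finrank ℝ (LinearMap.range (Matrix.toLin' P)) := by omega
  have h4 : (2 : ℝ) ≤ P.trace := by
    rw [htr]; exact_mod_cast h3
  rw [hP, Matrix.trace_smul, smul_eq_mul, inv_mul_eq_div, le_div_iff₀ hc] at h4
  exact h4

end LinearAlgebra

/-! ### Distance to the zero set from a slope bound. -/

section Slope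

variable {E : Type*} [NormedAddCommGroup E] [NormedSpace ℝ E]

lemma norm_fderiv_le_of_forall_sub_le {h : E → ℝ} {z : E} {c : ℝ} (hc : 0 ≤ c)
    (hd : DifferentiableAt ℝ h z) (hz : ∀ᶠ y in 𝓝 z, h z - c * ‖y - z‖ ≤ h y) :
    ‖fderiv ℝ h z‖ ≤ c := by
  have key : ∀ v, -(c * ‖v‖) ≤ fderiv ℝ h z v := by
    intro v
    have h1 : HasDerivAt (fun t : ℝ ↦ z + t • v) v 0 := by
      simpa using ((hasDerivAt_id (0 : ℝ)).smul_const v).const_add z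
    have h2 : HasDerivAt (fun t : ℝ ↦ h (z + t • v)) (fderiv ℝ h z v) 0 := by
      refine HasFDerivAt.comp_hasDerivAt (0 : ℝ) (l := h) ?_ h1
      simpa using hd.hasFDerivAt
    refine ge_of_tendsto h2.tendsto_slope_zero_right ?_
    have h3 : Tendsto (fun t : ℝ ↦ z + t • v) (𝓝[>] 0) (𝓝 z) := by
      simpa using h1.continuousAt.tendsto.mono_left nhdsWithin_le_nhds
    filter_upwards [h3.eventually hz, self_mem_nhdsWithin] with t ht ht0
    have ht0 : 0 < t := ht0
    simp only [zero_add, zero_smul, add_zero, smul_eq_mul, add_sub_cancel_left, norm_smul,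
      Real.norm_of_nonneg ht0.le] at ht ⊢
    rw [inv_mul_eq_div, le_div_iff₀ ht0]
    linarith
  refine ContinuousLinearMap.opNorm_le_bound _ hc fun v ↦ ?_
  rw [Real.norm_eq_abs, abs_le]
  refine ⟨key v, ?_⟩
  have := key (-v)
  rw [norm_neg, map_neg] at this
  linarith

/-- A nonnegative function whose square root has slope bounded below off its zero set controls the
distance to its zero set. -/
lemma exists_zero_near_of_slope [ProperSpace E] {F : E → ℝ} {y₀ : E} {κ : ℝ} (hκ : 0 < κ)
    (h0 : F y₀ = 0) (hF : ∀ᶠ y in 𝓝 y₀, 0 ≤ F y ∧ DifferentiableAt ℝ F y ∧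
      κ * Real.sqrt (F y) ≤ ‖fderiv ℝ F y‖) :
    ∀ᶠ y in 𝓝 y₀, ∃ z, F z = 0 ∧ ‖z - y‖ ≤ 4 / κ * Real.sqrt (F y) := by
  obtain ⟨r, hr, hball⟩ := Metric.nhds_basis_closedBall.eventually_iff.1 hF
  have hcont : ContinuousAt (fun y ↦ Real.sqrt (F y)) y₀ :=
    (hball (Metric.mem_closedBall_self hr.le)).2.1.continuousAt.sqrt
  have h1 : ∀ᶠ y in 𝓝 y₀, Real.sqrt (F y) < κ / 4 * (r / 2) :=
    hcont.eventually (gt_mem_nhds (by simp only [h0, Real.sqrt_zero]; positivity))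
  filter_upwards [h1, Metric.ball_mem_nhds y₀ (half_pos hr)] with y hy hyr
  have hon : ContinuousOn (fun z ↦ Real.sqrt (F z) + κ / 4 * ‖z - y‖) (Metric.closedBall y₀ r) :=
    fun z hz ↦ ((hball hz).2.1.continuousAt.sqrt.add
      (by fun_prop)).continuousWithinAt
  -- As in Ekeland's principle, the required zero is a minimizer of `√F` plus a penalty of slope `κ
  -- / 4`. Where `F z > 0`, minimality bounds the slope of `√F` by `κ / 4`, whereas the hypothesis
  -- makes it at least `κ / 2`.
  obtain ⟨z, hz, hmin⟩ := (isCompact_closedBall y₀ r).exists_isMinOn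
    ⟨y₀, Metric.mem_closedBall_self hr.le⟩ hon
  have hyy := hmin (Metric.ball_subset_closedBall (Metric.ball_subset_ball (by linarith) hyr))
  simp only [sub_self, norm_zero, mul_zero, add_zero, mem_ofPred_eq] at hyy
  have hzy : ‖z - y‖ ≤ 4 / κ * Real.sqrt (F y) := by
    have := Real.sqrt_nonneg (F z)
    have h2 : κ / 4 * ‖z - y‖ ≤ Real.sqrt (F y) := by linarith
    rw [div_mul_eq_mul_div, le_div_iff₀ hκ]
    linarith
  -- The minimizer must be interior for the first-order condition to hold in every direction.
  have hzin : z ∈ Metric.ball y₀ r := by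
    have h3 : ‖z - y‖ < r / 2 := by
      refine hzy.trans_lt ?_
      calc _ < 4 / κ * (κ / 4 * (r / 2)) := by gcongr
        _ = r / 2 := by field_simp
    rw [mem_ball_iff_norm] at hyr ⊢
    calc ‖z - y₀‖ = ‖(z - y) + (y - y₀)‖ := by congr 1; abel
      _ ≤ ‖z - y‖ + ‖y - y₀‖ := norm_add_le _ _
      _ < r := by linarith
  refine ⟨z, ?_, hzy⟩
  by_contra hne
  obtain ⟨hz0, hzd, hzs⟩ := hball hz
  have hpos : 0 < F z := hz0.lt_of_ne (Ne.symm hne)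
  have hsq : 0 < Real.sqrt (F z) := Real.sqrt_pos.2 hpos
  have hd := hzd.hasFDerivAt.sqrt hpos.ne'
  have hle := norm_fderiv_le_of_forall_sub_le (c := κ / 4) (by positivity) hd.differentiableAt (by
    filter_upwards [Metric.isOpen_ball.mem_nhds hzin] with x hx
    have h4 := hmin (Metric.ball_subset_closedBall hx)
    simp only [mem_ofPred_eq] at h4
    have h5 : ‖x - y‖ ≤ ‖x - z‖ + ‖z - y‖ := by
      simpa using norm_add_le (x - z) (z - y)
    have h6 : κ / 4 * ‖x - y‖ ≤ κ / 4 * (‖x - z‖ + ‖z - y‖) := by gcongr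
    linarith)
  rw [hd.fderiv, norm_smul, Real.norm_of_nonneg (by positivity), one_div, inv_mul_eq_div,
    div_le_iff₀ (by positivity)] at hle
  have : 0 < κ * Real.sqrt (F z) := by positivity
  linarith

end Slope

/-! ### Second-order expansion at a critical point. -/

section SecondOrder

variable {n : ℕ} {F : EuclideanSpace ℝ (Fin n) → ℝ} {y₀ : EuclideanSpace ℝ (Fin n)}

/-- The matrix of second partial derivatives. -/
def hessian (F : EuclideanSpace ℝ (Fin n) → ℝ) (y : EuclideanSpace ℝ (Fin n)) :
    Matrix (Fin n) (Fin n) ℝ :=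
  Matrix.of fun i j ↦ partialDeriv i (partialDeriv j F) y

lemma hessian_transpose (hF : ContDiffAt ℝ ∞ F y₀) : (hessian F y₀).transpose = hessian F y₀ := by
  have hsymm : IsSymmSndFDerivAt ℝ F y₀ := hF.isSymmSndFDerivAt (by simp [ENat.LEInfty.out])
  have hd : DifferentiableAt ℝ (fderiv ℝ F) y₀ :=
    (hF.fderiv_right (m := ∞) (by simp)).differentiableAt (by simp)
  have key : ∀ i j, hessian F y₀ i j = fderiv ℝ (fderiv ℝ F) y₀ (EuclideanSpace.single i 1)
      (EuclideanSpace.single j 1) := by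
    intro i j
    have : HasFDerivAt (partialDeriv j F) _ y₀ :=
      hd.hasFDerivAt.clm_apply (hasFDerivAt_const (EuclideanSpace.single j (1 : ℝ)) y₀)
    simp [hessian, partialDeriv, this.fderiv]
  ext i j
  rw [Matrix.transpose_apply, key, key]
  exact hsymm _ _

lemma hasDerivAt_line (y w : EuclideanSpace ℝ (Fin n)) (t : ℝ) :
    HasDerivAt (fun t : ℝ ↦ y + t • w) w t := by
  simpa using ((hasDerivAt_id t).smul_const w).const_add y

lemma tendsto_line (y w : EuclideanSpace ℝ (Fin n)) :
    Tendsto (fun t : ℝ ↦ y + t • w) (𝓝 0) (𝓝 y) := by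
  simpa using (hasDerivAt_line y w 0).continuousAt.tendsto

lemma tendsto_partialDeriv_div (hF : ContDiffAt ℝ ∞ F y₀) (h0 : ∀ i, partialDeriv i F y₀ = 0)
    (w : EuclideanSpace ℝ (Fin n)) (i : Fin n) :
    Tendsto (fun t : ℝ ↦ partialDeriv i F (y₀ + t • w) / t) (𝓝[≠] 0)
      (𝓝 ((hessian F y₀).mulVec w i)) := by
  have h1 : HasDerivAt (fun t : ℝ ↦ partialDeriv i F (y₀ + t • w))
      (fderiv ℝ (partialDeriv i F) y₀ w) 0 := by
    refine HasFDerivAt.comp_hasDerivAt (0 : ℝ) (l := partialDeriv i F) ?_ (hasDerivAt_line y₀ w 0)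
    simpa using ((contDiffAt_partialDeriv hF (m := ∞) (by simp) i).differentiableAt
      (by simp)).hasFDerivAt
  have h2 := h1.tendsto_slope_zero
  rw [fderiv_eq_sum_partialDeriv] at h2
  have h3 : (hessian F y₀).mulVec w i = ∑ j, w j * partialDeriv j (partialDeriv i F) y₀ := by
    rw [← hessian_transpose hF]
    simp [Matrix.mulVec, dotProduct, hessian, mul_comm]
  rw [h3]
  refine h2.congr fun t ↦ ?_
  simp [h0, div_eq_inv_mul]

lemma tendsto_sub_div_sq (hF : ContDiffAt ℝ ∞ F y₀) (h0 : ∀ i, partialDeriv i F y₀ = 0)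
    (w : EuclideanSpace ℝ (Fin n)) :
    Tendsto (fun t : ℝ ↦ (F (y₀ + t • w) - F y₀) / t ^ 2) (𝓝[≠] 0)
      (𝓝 (w ⬝ᵥ (hessian F y₀).mulVec w / 2)) := by
  have hd : ∀ᶠ y in 𝓝 y₀, DifferentiableAt ℝ F y :=
    ((hF.of_le (m := 1) (by simp)).eventually (by simp)).mono
      fun y hy ↦ hy.differentiableAt (by simp)
  have hd' := ((tendsto_line y₀ w).mono_left (nhdsWithin_le_nhds (s := {0}ᶜ))).eventually hd
  refine HasDerivAt.lhopital_zero_nhdsNE (f' := fun t ↦ fderiv ℝ F (y₀ + t • w) w)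
    (g' := fun t ↦ 2 * t) ?_ ?_ ?_ ?_ ?_ ?_
  · filter_upwards [hd'] with t ht
    exact (ht.hasFDerivAt.comp_hasDerivAt t (hasDerivAt_line y₀ w t)).sub_const _
  · exact Eventually.of_forall fun t ↦ by simpa using hasDerivAt_pow 2 t
  · filter_upwards [self_mem_nhdsWithin] with t ht
    simpa using ht
  · have := (hF.continuousAt.tendsto.comp (tendsto_line y₀ w)).sub_const (F y₀)
    rw [sub_self] at this
    exact this.mono_left nhdsWithin_le_nhds
  · have : Tendsto (fun t : ℝ ↦ t ^ 2) (𝓝 0) (𝓝 (0 ^ 2)) := (continuous_pow 2).tendsto 0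
    simp only [ne_eq, OfNat.ofNat_ne_zero, not_false_eq_true, zero_pow] at this
    exact this.mono_left nhdsWithin_le_nhds
  · have : Tendsto (fun t : ℝ ↦ (∑ i, w i * (partialDeriv i F (y₀ + t • w) / t)) / 2) (𝓝[≠] 0)
        (𝓝 (w ⬝ᵥ (hessian F y₀).mulVec w / 2)) :=
      (tendsto_finsetSum _ fun i _ ↦ (tendsto_partialDeriv_div hF h0 w i).const_mul (w i)).div_const
        2
    refine this.congr fun t ↦ ?_
    rw [fderiv_eq_sum_partialDeriv, Finset.sum_div, Finset.sum_div]
    exact Finset.sum_congr rfl fun i _ ↦ by rw [← mul_div_assoc, div_div, mul_comm t]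

end SecondOrder

/-! ### Tangent directions of a zero set. -/

section Tangent

variable {E : Type*} [NormedAddCommGroup E] [NormedSpace ℝ E]

/-- A direction along which a function has distance to its zero set of second order is mapped into
`V` by the derivative of a map sending the zero set into a translate of `V`. -/
lemma fderiv_apply_mem_of_zero_near {E' : Type*} [NormedAddCommGroup E'] [NormedSpace ℝ E']
    {F : E → ℝ} {y₀ w : E} {C : ℝ}
    (hF : ∀ᶠ y in 𝓝 y₀, ∃ z, F z = 0 ∧ ‖z - y‖ ≤ C * Real.sqrt (F y))
    (hw : Tendsto (fun t : ℝ ↦ F (y₀ + t • w) / t ^ 2) (𝓝[>] 0) (𝓝 0))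
    {Φ : E → E'} (hΦ : DifferentiableAt ℝ Φ y₀) {V : Submodule ℝ E'} (hV : IsClosed (V : Set E'))
    (hΦV : ∀ᶠ z in 𝓝 y₀, F z = 0 → Φ z - Φ y₀ ∈ V) : fderiv ℝ Φ y₀ w ∈ V := by
  classical
  have hline : Tendsto (fun t : ℝ ↦ y₀ + t • w) (𝓝[>] 0) (𝓝 y₀) := by
    have : Continuous fun t : ℝ ↦ y₀ + t • w := by fun_prop
    simpa using (this.tendsto 0).mono_left nhdsWithin_le_nhds
  have hev := hline.eventually hF
  -- A nearby zero for each point of the line. Its distance to the line is `o(t)`, so `z` has right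
  -- derivative `w` at `0`; the default value `y₀` matters only off a neighbourhood of `0`.
  let z : ℝ → E := fun t ↦ if h : ∃ z, F z = 0 ∧ ‖z - (y₀ + t • w)‖ ≤ C * Real.sqrt (F (y₀ + t • w))
    then h.choose else y₀
  have hz : ∀ᶠ t in 𝓝[>] (0 : ℝ), F (z t) = 0 ∧
      ‖z t - (y₀ + t • w)‖ ≤ C * Real.sqrt (F (y₀ + t • w)) := by
    filter_upwards [hev] with t ht
    simp only [z, dif_pos ht]
    exact ht.choose_spec
  have hlim : Tendsto (fun t : ℝ ↦ t⁻¹ • (z t - y₀)) (𝓝[>] 0) (𝓝 w) := by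
    rw [tendsto_iff_norm_sub_tendsto_zero]
    have h1 : Tendsto (fun t : ℝ ↦ C * Real.sqrt (F (y₀ + t • w) / t ^ 2)) (𝓝[>] 0) (𝓝 0) := by
      simpa using (hw.sqrt).const_mul C
    refine squeeze_zero' (Eventually.of_forall fun t ↦ norm_nonneg _) ?_ h1
    filter_upwards [hz, self_mem_nhdsWithin] with t ht ht0
    have ht0 : 0 < t := ht0
    have : t⁻¹ • (z t - y₀) - w = t⁻¹ • (z t - (y₀ + t • w)) := by
      rw [← sub_sub, smul_sub t⁻¹ (z t - y₀), smul_smul, inv_mul_cancel₀ ht0.ne', one_smul]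
    rw [this, norm_smul, norm_inv, Real.norm_of_nonneg ht0.le, Real.sqrt_div' _ (by positivity),
      Real.sqrt_sq ht0.le, inv_mul_eq_div, ← mul_div_assoc]
    gcongr
    exact ht.2
  have hz0 : Tendsto z (𝓝[>] 0) (𝓝 y₀) := by
    have h1 : Tendsto (fun t : ℝ ↦ t) (𝓝[>] 0) (𝓝 0) := nhdsWithin_le_nhds
    have h2 := (h1.smul hlim).add_const y₀
    rw [zero_smul, zero_add] at h2
    refine h2.congr' ?_
    filter_upwards [self_mem_nhdsWithin] with t ht0
    have ht0 : 0 < t := ht0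
    rw [smul_smul, mul_inv_cancel₀ ht0.ne', one_smul, sub_add_cancel]
  have hcomp : Tendsto (fun t : ℝ ↦ t⁻¹ • (Φ (z t) - Φ y₀)) (𝓝[>] 0) (𝓝 (fderiv ℝ Φ y₀ w)) := by
    have := hΦ.hasFDerivAt.hasFDerivWithinAt (s := univ) |>.lim (d := fun t ↦ z t - y₀)
      (by simpa using hz0.sub_const y₀) (Eventually.of_forall fun _ ↦ mem_univ _) hlim
    simpa using this
  refine hV.mem_of_tendsto hcomp ?_
  filter_upwards [hz, hz0.eventually hΦV] with t ht ht2
  exact V.smul_mem _ (ht2 ht.1)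

end Tangent

/-! ### The Hessian of `f` on the minimum level. -/

section FocalHessian

variable {n : ℕ} {M : Type*} [TopologicalSpace M] [ChartedSpace (EuclideanSpace ℝ (Fin n)) M]
  [IsManifold (𝓡 n) ∞ M] [RiemannianBundle (fun x : M ↦ TangentSpace (𝓡 n) x)]
  [IsContMDiffRiemannianBundle (𝓡 n) ∞ (EuclideanSpace ℝ (Fin n))
      (fun x : M ↦ TangentSpace (𝓡 n) x)]

lemma exists_norm_grad_le_norm_fderiv {f : M → ℝ} (hf : ContMDiff (𝓡 n) 𝓘(ℝ, ℝ) ∞ f)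
    {ψ : OpenPartialHomeomorph M (EuclideanSpace ℝ (Fin n))}
    (hψ : ψ ∈ IsManifold.maximalAtlas (𝓡 n) ∞ M) {y₀ : EuclideanSpace ℝ (Fin n)}
    (hy₀ : y₀ ∈ ψ.target) :
    ∃ C > 0, ∀ᶠ y in 𝓝 y₀, ‖grad n f (ψ.symm y)‖ ≤ C * ‖fderiv ℝ (f ∘ ψ.symm) y‖ := by
  have hcont : ContinuousAt (fun y ↦ ∑ i, ∑ j, |(metricMatrix ψ y)⁻¹ i j|) y₀ :=
    tendsto_finsetSum _ fun i _ ↦ tendsto_finsetSum _ fun j _ ↦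
      (contDiffAt_inv_metricMatrix hψ hy₀ i j).continuousAt.abs
  have hev := hcont.eventually (gt_mem_nhds (lt_add_one _))
  set C := ∑ i, ∑ j, |(metricMatrix ψ y₀)⁻¹ i j| + 1
  have hC : 0 < C := by positivity
  refine ⟨Real.sqrt C, Real.sqrt_pos.2 hC, ?_⟩
  filter_upwards [hev, ψ.open_target.mem_nhds hy₀] with y hy hyt
  set D := ‖fderiv ℝ (f ∘ ψ.symm) y‖
  have hp : ∀ i, |partialDeriv i (f ∘ ψ.symm) y| ≤ D := fun i ↦ by
    simpa [partialDeriv, D] using (fderiv ℝ (f ∘ ψ.symm) y).le_opNorm (EuclideanSpace.single i (1 : ℝ))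
  have hsq : ‖grad n f (ψ.symm y)‖ ^ 2 ≤ C * D ^ 2 := by
    rw [norm_grad_sq hψ hyt ((hf (ψ.symm y)).mdifferentiableAt (by simp))]
    calc _ ≤ ∑ i, ∑ j, |(metricMatrix ψ y)⁻¹ i j| * D ^ 2 := by
          refine Finset.sum_le_sum fun i _ ↦ Finset.sum_le_sum fun j _ ↦ (le_abs_self _).trans ?_
          rw [abs_mul, abs_mul, mul_assoc, sq]
          gcongr
          exacts [hp i, hp j]
      _ = (∑ i, ∑ j, |(metricMatrix ψ y)⁻¹ i j|) * D ^ 2 := by simp only [Finset.sum_mul]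
      _ ≤ C * D ^ 2 := by gcongr
  have := Real.abs_le_sqrt hsq
  rwa [Real.sqrt_mul hC.le, Real.sqrt_sq (norm_nonneg _), abs_of_nonneg (norm_nonneg _)] at this

/-- At a point of the minimum level, where the profile `b` of `|∇ f|²` has slope `β > 0`, the
codimension assumption forces the Laplacian to be at most `-β`. -/
lemma le_neg_laplacian_of_mem_minLevel {f : M → ℝ} (hf : ContMDiff (𝓡 n) 𝓘(ℝ, ℝ) ∞ f)
    {b : ℝ → ℝ} {I : Set ℝ} {x₀ : M} (hI : ∀ x, f x ∈ I) (hx₀ : x₀ ∈ minLevel f) {β : ℝ}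
    (hβ : 0 < β) (hb : HasDerivWithinAt b β I (f x₀)) (hb0 : b (f x₀) = 0)
    (hgrad : ∀ x, ‖grad n f x‖ ^ 2 = b (f x)) {d : ℕ} (hd : d + 1 < n)
    (hsub : IsSubmanifoldAt (n := n) d (minLevel f) x₀) : β ≤ -laplacian n f x₀ := by
  obtain ⟨χ, hχ, hxχ, V, hVd, hV⟩ := hsub
  set ψ := chartAt (EuclideanSpace ℝ (Fin n)) x₀ with hψdef
  have hψ : ψ ∈ IsManifold.maximalAtlas (𝓡 n) ∞ M := IsManifold.chart_mem_maximalAtlas x₀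
  have hxs : x₀ ∈ ψ.source := mem_chart_source _ x₀
  have hy : ψ x₀ ∈ ψ.target := ψ.map_source hxs
  have hsx : ψ.symm (ψ x₀) = x₀ := ψ.left_inv hxs
  set y₀ := ψ x₀ with hy₀
  set F : EuclideanSpace ℝ (Fin n) → ℝ := f ∘ ψ.symm with hFdef
  have hFx : F y₀ = f x₀ := by simp [hFdef, hsx]
  have hF : ContDiffAt ℝ ∞ F y₀ := contDiffAt_comp_symm hψ hy le_rfl (hf _)
  have h0 : ∀ i, partialDeriv i F y₀ = 0 :=
    partialDeriv_eq_zero_of_mem_minLevel (by rwa [hsx])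
  set H := hessian F y₀ with hH
  have hHT : H.transpose = H := hessian_transpose hF
  set A := (metricMatrix ψ y₀)⁻¹ with hA
  have hAT : A.transpose = A := by
    have := (metricMatrix_posDef hψ hy).isHermitian.inv
    rwa [Matrix.IsHermitian, Matrix.conjTranspose_eq_transpose_of_trivial] at this
  have hFI : Tendsto F (𝓝 y₀) (𝓝[I] (f x₀)) :=
    tendsto_nhdsWithin_iff.2 ⟨hFx ▸ hF.continuousAt, Eventually.of_forall fun y ↦ hI _⟩
  have hlo := hasDerivWithinAt_iff_isLittleO.1 hb
  simp only [hb0, sub_zero, smul_eq_mul] at hlo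
  -- Divide `|∇f|² = b ∘ f` by `t²` along the line in direction `w`. The left side tends to the form
  -- of `A` at `H w`, the right side to `β` times half the Hessian form.
  have hquad : ∀ w : EuclideanSpace ℝ (Fin n),
      H.mulVec w ⬝ᵥ A.mulVec (H.mulVec w) = β / 2 * (w ⬝ᵥ H.mulVec w) := by
    intro w
    have hl : Tendsto (fun t : ℝ ↦ y₀ + t • w) (𝓝[≠] 0) (𝓝 y₀) :=
      (tendsto_line y₀ w).mono_left nhdsWithin_le_nhds
    have h1 := tendsto_partialDeriv_div hF h0 w
    have h2 : ∀ i j, Tendsto (fun t : ℝ ↦ (metricMatrix ψ (y₀ + t • w))⁻¹ i j) (𝓝[≠] 0)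
        (𝓝 (A i j)) := fun i j ↦
      (contDiffAt_inv_metricMatrix hψ hy i j).continuousAt.tendsto.comp hl
    have h3 : Tendsto (fun t : ℝ ↦ ∑ i, ∑ j, (metricMatrix ψ (y₀ + t • w))⁻¹ i j *
        (partialDeriv i F (y₀ + t • w) / t) * (partialDeriv j F (y₀ + t • w) / t)) (𝓝[≠] 0)
        (𝓝 (∑ i, ∑ j, A i j * H.mulVec w i * H.mulVec w j)) :=
      tendsto_finsetSum _ fun i _ ↦ tendsto_finsetSum _ fun j _ ↦
        ((h2 i j).mul (h1 i)).mul (h1 j)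
    have h4 := tendsto_sub_div_sq hF h0 w
    have h5 : Tendsto (fun t : ℝ ↦ b (F (y₀ + t • w)) / t ^ 2) (𝓝[≠] 0)
        (𝓝 (β * (w ⬝ᵥ H.mulVec w / 2))) := by
      have hO : (fun t : ℝ ↦ F (y₀ + t • w) - f x₀) =O[𝓝[≠] 0] fun t ↦ t ^ 2 := by
        refine Asymptotics.isBigO_of_div_tendsto_nhds ?_ _ (hFx ▸ h4)
        filter_upwards [self_mem_nhdsWithin] with t ht h
        exact absurd (pow_eq_zero_iff two_ne_zero |>.1 h) ht
      have ho := ((hlo.comp_tendsto (hFI.comp hl)).trans_isBigO hO).tendsto_div_nhds_zero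
      have := ho.add (h4.const_mul β)
      rw [zero_add] at this
      refine this.congr fun t ↦ ?_
      simp only [Function.comp, hFx]
      ring
    have h6 : Tendsto (fun t : ℝ ↦ b (F (y₀ + t • w)) / t ^ 2) (𝓝[≠] 0)
        (𝓝 (∑ i, ∑ j, A i j * H.mulVec w i * H.mulVec w j)) := by
      refine h3.congr' ?_
      filter_upwards [hl.eventually (ψ.open_target.mem_nhds hy)] with t ht
      have : b (F (y₀ + t • w)) = ‖grad n f (ψ.symm (y₀ + t • w))‖ ^ 2 := (hgrad _).symm
      rw [this, norm_grad_sq hψ ht ((hf _).mdifferentiableAt (by simp)), Finset.sum_div]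
      refine Finset.sum_congr rfl fun i _ ↦ ?_
      rw [Finset.sum_div]
      refine Finset.sum_congr rfl fun j _ ↦ ?_
      ring
    have h7 := tendsto_nhds_unique h6 h5
    have h8 : ∀ v : Fin n → ℝ, v ⬝ᵥ A.mulVec v = ∑ i, ∑ j, A i j * v i * v j := by
      intro v
      rw [dotProduct]
      refine Finset.sum_congr rfl fun i _ ↦ ?_
      rw [Matrix.mulVec, dotProduct, Finset.mul_sum]
      exact Finset.sum_congr rfl fun j _ ↦ by ring
    rw [h8, h7]
    ring
  -- Near the minimum `b(f) ≥ (β / 2) (f - f x₀)`, which is the slope bound needed for `√(f - f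
  -- x₀)`.
  have hzero : ∃ C, ∀ᶠ y in 𝓝 y₀, ∃ z, F z - f x₀ = 0 ∧ ‖z - y‖ ≤ C * Real.sqrt (F y - f x₀) := by
    obtain ⟨C, hC, hCgrad⟩ := exists_norm_grad_le_norm_fderiv hf hψ hy
    refine ⟨_, exists_zero_near_of_slope (F := fun y ↦ F y - f x₀)
      (κ := Real.sqrt (β / 2) / C) (by positivity) (by simp [hFx]) ?_⟩
    filter_upwards [hCgrad, hFI.eventually (hlo.bound (half_pos hβ)),
      ψ.open_target.mem_nhds hy] with y h1 h2 hyt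
    have hnn : 0 ≤ F y - f x₀ := sub_nonneg.2 (hx₀ _)
    refine ⟨hnn, ?_, ?_⟩
    · exact ((contDiffAt_comp_symm hψ hyt le_rfl (hf _)).differentiableAt (by simp)).sub_const _
    · rw [fderiv_sub_const, div_mul_eq_mul_div, div_le_iff₀ hC, mul_comm _ C]
      refine le_trans ?_ h1
      rw [← Real.sqrt_mul (by positivity)]
      refine Real.sqrt_le_iff.2 ⟨norm_nonneg _, ?_⟩
      rw [hgrad]
      rw [Real.norm_of_nonneg hnn, Real.norm_eq_abs] at h2
      have := (abs_le.1 h2).1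
      have h3 : b (F y) = b (f (ψ.symm y)) := rfl
      linarith
  -- The Laplacian is computed in `ψ` while the submanifold is flat in `χ`; the transition map
  -- carries the kernel of `H` injectively into the slice `V`, of dimension at most `n - 2`.
  set Φ : EuclideanSpace ℝ (Fin n) → EuclideanSpace ℝ (Fin n) := χ ∘ ψ.symm with hΦ
  have hmd := (mdifferentiable_of_mem_maximalAtlas hψ).symm.trans
    (mdifferentiable_of_mem_maximalAtlas hχ)
  have hysrc : y₀ ∈ (ψ.symm.trans χ).source := by
    simp only [mfld_simps]
    exact ⟨hy, by rwa [hsx]⟩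
  have hΦd : DifferentiableAt ℝ Φ y₀ := (hmd.mdifferentiableAt hysrc).differentiableAt
  have hΦinj : Function.Injective (fderiv ℝ Φ y₀) := by
    have := hmd.mfderiv_injective hysrc
    rwa [mfderiv_eq_fderiv] at this
  have hΦV : ∀ᶠ z in 𝓝 y₀, F z - f x₀ = 0 → Φ z - Φ y₀ ∈ V := by
    have hc : ContinuousAt ψ.symm y₀ := ψ.continuousAt_symm hy
    have : ∀ᶠ z in 𝓝 y₀, ψ.symm z ∈ χ.source :=
      hc.eventually (χ.open_source.mem_nhds (by rwa [hsx]))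
    filter_upwards [this] with z hz hFz
    simp only [hΦ, Function.comp, hsx]
    refine (hV _ hz).1 fun y ↦ ?_
    have : f (ψ.symm z) = f x₀ := sub_eq_zero.1 hFz
    rw [this]
    exact hx₀ y
  have hmem : ∀ w : EuclideanSpace ℝ (Fin n), H.mulVec w = 0 → fderiv ℝ Φ y₀ w ∈ V := by
    intro w hw
    obtain ⟨C, hC⟩ := hzero
    refine fderiv_apply_mem_of_zero_near (F := fun y ↦ F y - f x₀) hC ?_ hΦd
      V.closed_of_finiteDimensional hΦV
    have := (tendsto_sub_div_sq hF h0 w).mono_left (nhdsGT_le_nhdsNE (0 : ℝ))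
    rw [← hH, hw, dotProduct_zero, zero_div] at this
    rwa [← hFx]
  have hker : Module.finrank ℝ (LinearMap.ker (Matrix.toLin' H)) + 2 ≤ n := by
    let L : (Fin n → ℝ) →ₗ[ℝ] EuclideanSpace ℝ (Fin n) :=
      (fderiv ℝ Φ y₀).toLinearMap ∘ₗ (WithLp.linearEquiv 2 ℝ (Fin n → ℝ)).symm.toLinearMap
    have hL : Function.Injective L := hΦinj.comp (WithLp.linearEquiv 2 ℝ (Fin n → ℝ)).symm.injective
    have h1 := (Submodule.equivMapOfInjective L hL (LinearMap.ker (Matrix.toLin' H))).finrank_eq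
    have h2 : Submodule.map L (LinearMap.ker (Matrix.toLin' H)) ≤ V := by
      rintro _ ⟨w, hw, rfl⟩
      exact hmem (WithLp.toLp 2 w) (by simpa using hw)
    have h3 := Submodule.finrank_mono h2
    omega
  have htr := two_mul_le_trace (half_pos hβ) hAT hHT (fun w ↦ hquad (WithLp.toLp 2 w)) hker
  rw [laplacian_of_partialDeriv_eq_zero hf hψdef h0, neg_neg]
  have : (A * H).trace = ∑ i, ∑ j, A i j * partialDeriv i (partialDeriv j F) y₀ := by
    rw [Matrix.trace]
    refine Finset.sum_congr rfl fun i _ ↦ ?_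
    rw [Matrix.diag_apply, Matrix.mul_apply]
    refine Finset.sum_congr rfl fun j _ ↦ ?_
    rw [← hHT, Matrix.transpose_apply]
    rfl
  rw [← this]
  linarith

end FocalHessian

/-! ### Ordinary differential inequalities, regular and singular. -/

section ODE

variable {E : Type*} [NormedAddCommGroup E] [NormedSpace ℝ E]

/-- Grönwall to the right of `c`, and to the left after the reflection `t ↦ -t`. -/
lemma eq_zero_of_norm_deriv_le {w w' : ℝ → E} {C p r c : ℝ} (hc : c ∈ Icc p r)
    (hw : ∀ t ∈ Icc p r, HasDerivAt w (w' t) t) (hle : ∀ t ∈ Icc p r, ‖w' t‖ ≤ C * ‖w t‖)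
    (h0 : w c = 0) : ∀ t ∈ Icc p r, w t = 0 := by
  intro t ht
  rcases le_total c t with hct | hct
  · have hsub : Icc c r ⊆ Icc p r := Icc_subset_Icc_left hc.1
    exact eq_zero_of_abs_deriv_le_mul_abs_self_of_eq_zero_right (K := C)
      (fun x hx ↦ (hw x (hsub hx)).continuousAt.continuousWithinAt)
      (fun x hx ↦ (hw x (hsub (Ico_subset_Icc_self hx))).hasDerivWithinAt) h0
      (fun x hx ↦ hle x (hsub (Ico_subset_Icc_self hx))) t ⟨hct, ht.2⟩
  · have hmem : ∀ x ∈ Icc (-c) (-p), -x ∈ Icc p r := fun x hx ↦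
      ⟨by linarith [hx.2], by linarith [hx.1, hc.2]⟩
    have hd : ∀ x ∈ Icc (-c) (-p), HasDerivAt (fun x ↦ w (-x)) (-w' (-x)) x := fun x hx ↦ by
      simpa [Function.comp_def] using (hw _ (hmem x hx)).scomp x (hasDerivAt_neg x)
    have := eq_zero_of_abs_deriv_le_mul_abs_self_of_eq_zero_right (K := C)
      (f := fun x ↦ w (-x)) (f' := fun x ↦ -w' (-x)) (a := -c) (b := -p)
      (fun x hx ↦ (hd x hx).continuousAt.continuousWithinAt)
      (fun x hx ↦ (hd x (Ico_subset_Icc_self hx)).hasDerivWithinAt) (by simpa using h0)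
      (fun x hx ↦ by simpa using hle _ (hmem x (Ico_subset_Icc_self hx))) (-t)
      ⟨by linarith, by linarith [ht.1]⟩
    simpa using this

/-- Uniqueness for second-order linear differential inequalities. -/
lemma eq_zero_of_abs_deriv_deriv_le {φ : ℝ → ℝ} {α γ c : ℝ} (hc : c ∈ Ioo α γ)
    (hφ : ∀ t ∈ Ioo α γ, ContDiffAt ℝ 2 φ t)
    (hle : ∀ p r, α < p → r < γ → ∃ C, ∀ t ∈ Icc p r,
      |deriv (deriv φ) t| ≤ C * (|φ t| + |deriv φ t|))
    (h0 : φ c = 0) (h1 : deriv φ c = 0) : ∀ t ∈ Ioo α γ, φ t = 0 := by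
  intro t ht
  have hp : α < min c t := lt_min hc.1 ht.1
  have hr : max c t < γ := max_lt hc.2 ht.2
  obtain ⟨C, hC⟩ := hle _ _ hp hr
  have hsub : Icc (min c t) (max c t) ⊆ Ioo α γ := fun x hx ↦ ⟨hp.trans_le hx.1, hx.2.trans_lt hr⟩
  -- Reduction to a first-order system in the sup norm: the summand `1` serves the first component,
  -- and `2 * |C|` the second.
  have := eq_zero_of_norm_deriv_le (w := fun t ↦ (φ t, deriv φ t))
    (w' := fun t ↦ (deriv φ t, deriv (deriv φ) t)) (C := 2 * |C| + 1) (p := min c t) (r := max c t)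
    (c := c) ⟨min_le_left _ _, le_max_left _ _⟩ (fun x hx ↦ ?_) (fun x hx ↦ ?_) (by simp [h0, h1])
    t ⟨min_le_right _ _, le_max_right _ _⟩
  · exact (Prod.ext_iff.1 this).1
  · have h := hφ x (hsub hx)
    have h' : ContDiffAt ℝ 1 (deriv φ) x := h.derivWithin (by norm_num)
    exact (h.differentiableAt (by simp)).hasDerivAt.prodMk
      (h'.differentiableAt (by simp)).hasDerivAt
  · have h2 := hC x hx
    simp only [Prod.norm_mk, Real.norm_eq_abs]
    set m := max |φ x| |deriv φ x|
    have h3 : |φ x| ≤ m := le_max_left _ _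
    have h4 : |deriv φ x| ≤ m := le_max_right _ _
    have hm : 0 ≤ m := (abs_nonneg _).trans h3
    have h5 : 0 ≤ 2 * |C| * m := by positivity
    refine max_le (by linarith) (h2.trans ?_)
    calc _ ≤ |C| * (m + m) := by
          refine mul_le_mul (le_abs_self C) (by linarith) (by positivity) (abs_nonneg _)
      _ ≤ _ := by linarith

/-- If `φ` is bounded below to the right of `α` then `(t - α) φ'` cannot stay above a positive
constant. -/
lemma not_const_div_le_deriv {φ : ℝ → ℝ} {α T m : ℝ} (hT : α < T) (hm : 0 < m)
    (hφ0 : ∀ t ∈ Ioc α T, 0 ≤ φ t) (hd : ∀ t ∈ Ioc α T, DifferentiableAt ℝ φ t)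
    (hle : ∀ t ∈ Ioc α T, m / (t - α) ≤ deriv φ t) : False := by
  have hmono : MonotoneOn (fun t ↦ φ t - m * Real.log (t - α)) (Ioc α T) := by
    have hder : ∀ t ∈ Ioc α T, HasDerivAt (fun t ↦ φ t - m * Real.log (t - α))
        (deriv φ t - m * (1 / (t - α))) t := fun t ht ↦
      (hd t ht).hasDerivAt.sub
        ((((hasDerivAt_id t).sub_const α).log (sub_pos.2 ht.1).ne').const_mul m)
    refine monotoneOn_of_deriv_nonneg (convex_Ioc α T)
      (fun t ht ↦ (hder t ht).continuousAt.continuousWithinAt)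
      (fun t ht ↦ (hder t (interior_subset ht)).differentiableAt.differentiableWithinAt)
      fun t ht ↦ ?_
    rw [(hder t (interior_subset ht)).deriv, mul_one_div]
    exact sub_nonneg.2 (hle t (interior_subset ht))
  -- Moving from `T` to `α + (T - α) e⁻ˣ` lowers the logarithmic term by `m x = φ T + 1`, which
  -- would force `φ ≤ -1`.
  set x := (φ T + 1) / m with hx
  have hφT := hφ0 T ⟨hT, le_rfl⟩
  have hx0 : 0 ≤ x := by positivity
  have hT' : 0 < T - α := sub_pos.2 hT
  have he1 : Real.exp (-x) ≤ 1 := Real.exp_le_one_iff.2 (by linarith)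
  have ht : α + (T - α) * Real.exp (-x) ∈ Ioc α T := by
    refine ⟨by have : 0 < (T - α) * Real.exp (-x) := by positivity
               linarith, ?_⟩
    have := mul_le_of_le_one_right hT'.le he1
    linarith
  have h1 := hmono ht ⟨hT, le_rfl⟩ ht.2
  simp only [add_sub_cancel_left] at h1
  rw [Real.log_mul hT'.ne' (Real.exp_pos _).ne', Real.log_exp] at h1
  have h2 := hφ0 _ ht
  have h3 : m * x = φ T + 1 := by rw [hx]; field_simp
  linarith

/-- The flux `W = b φ'` of a nonnegative subsolution is bounded at a point by the growth that its
differential inequality allows. -/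
lemma flux_le {φ W W' : ℝ → ℝ} {α T B C₁ k : ℝ} (hT : α < T) (hB : 0 < B) (hC₁ : 0 ≤ C₁)
    (hk : 0 ≤ k) (hφ0 : ∀ t ∈ Ioc α T, 0 ≤ φ t) (hd : ∀ t ∈ Ioc α T, DifferentiableAt ℝ φ t)
    (hW : ∀ t ∈ Ioc α T, HasDerivAt W (W' t) t)
    (hWle : ∀ t ∈ Ioc α T, 0 < W t → W t ≤ B * (t - α) * deriv φ t)
    (hW' : ∀ t ∈ Ioc α T, 0 < W t → W' t ≤ k + C₁ * W t) :
    W T ≤ Real.exp (C₁ * (T - α)) * (k * (T - α)) := by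
  by_contra! hlt
  -- With the integrating factor, `Y` is nonincreasing wherever `W > 0`. If `Y T > 0`, this
  -- propagates leftwards and keeps `W ≥ Y T`.
  set Y : ℝ → ℝ := fun t ↦ Real.exp (-(C₁ * (t - α))) * W t - k * (t - α) with hY
  have hYT : 0 < Y T := by
    rw [hY]
    simp only
    rw [Real.exp_neg, inv_mul_eq_div, sub_pos, lt_div_iff₀ (Real.exp_pos _), mul_comm]
    exact hlt
  have hYd : ∀ t ∈ Ioc α T, HasDerivAt Y (Real.exp (-(C₁ * (t - α))) * (-(C₁ * 1)) * W t +
      Real.exp (-(C₁ * (t - α))) * W' t - k * 1) t := fun t ht ↦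
    (((((hasDerivAt_id t).sub_const α).const_mul C₁).neg.exp).mul (hW t ht)).sub
      (((hasDerivAt_id t).sub_const α).const_mul k)
  have hYW : ∀ t ∈ Ioc α T, 0 < Y t → Y t ≤ W t := by
    intro t ht hYt
    have ht' : 0 ≤ t - α := (sub_pos.2 ht.1).le
    have h1 : Real.exp (-(C₁ * (t - α))) ≤ 1 :=
      Real.exp_le_one_iff.2 (neg_nonpos.2 (by positivity))
    have h2 : 0 ≤ k * (t - α) := by positivity
    have h3 : 0 < Real.exp (-(C₁ * (t - α))) * W t := by
      have : Y t = Real.exp (-(C₁ * (t - α))) * W t - k * (t - α) := rfl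
      linarith
    have h4 : 0 < W t := (pos_iff_pos_of_mul_pos h3).1 (Real.exp_pos _)
    have h5 := mul_le_of_le_one_left h4.le h1
    simp only [hY]
    linarith
  have hanti : ∀ s, α < s → (∀ t ∈ Ioc s T, 0 < W t) → ∀ t ∈ Icc s T, Y T ≤ Y t := by
    intro s hs hpos t ht
    have hsub : Icc s T ⊆ Ioc α T := fun x hx ↦ ⟨hs.trans_le hx.1, hx.2⟩
    have : AntitoneOn Y (Icc s T) := by
      refine antitoneOn_of_deriv_nonpos (convex_Icc s T)
        (fun x hx ↦ (hYd x (hsub hx)).continuousAt.continuousWithinAt)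
        (fun x hx ↦ (hYd x (hsub (interior_subset hx))).differentiableAt.differentiableWithinAt)
        fun x hx ↦ ?_
      rw [interior_Icc] at hx
      have hx' : x ∈ Ioc α T := ⟨hs.trans hx.1, hx.2.le⟩
      rw [(hYd x hx').deriv]
      have h1 := hW' x hx' (hpos x ⟨hx.1, hx.2.le⟩)
      have h2 : Real.exp (-(C₁ * (x - α))) ≤ 1 :=
        Real.exp_le_one_iff.2 (neg_nonpos.2 (mul_nonneg hC₁ (sub_pos.2 hx'.1).le))
      have h3 : Real.exp (-(C₁ * (x - α))) * (W' x - C₁ * W x) ≤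
          Real.exp (-(C₁ * (x - α))) * k := by gcongr; linarith
      have h4 := mul_le_of_le_one_left hk h2
      linarith
    exact this ht ⟨ht.1.trans ht.2, le_rfl⟩ ht.2
  have hpos : ∀ t ∈ Ioc α T, 0 < W t := by
    by_contra! hcon
    obtain ⟨t₁, ht₁, hWt₁⟩ := hcon
    have hsub : Icc t₁ T ⊆ Ioc α T := fun x hx ↦ ⟨ht₁.1.trans_le hx.1, hx.2⟩
    have hWc : ContinuousOn W (Icc t₁ T) := fun x hx ↦
      (hW x (hsub hx)).continuousAt.continuousWithinAt
    have hclosed : IsClosed (Icc t₁ T ∩ W ⁻¹' Iic 0) :=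
      hWc.preimage_isClosed_of_isClosed isClosed_Icc isClosed_Iic
    have hcomp : IsCompact (Icc t₁ T ∩ W ⁻¹' Iic 0) :=
      isCompact_Icc.of_isClosed_subset hclosed inter_subset_left
    -- At the last point `s` where `W ≤ 0`, monotonicity of `Y` on `[s, T]` would still give `W s ≥
    -- Y T > 0`.
    obtain ⟨s, ⟨hs, hWs⟩, hmax⟩ := hcomp.exists_isGreatest ⟨t₁, ⟨le_rfl, ht₁.2⟩, hWt₁⟩
    have h1 := hanti s (hsub hs).1 (fun t ht ↦ by
      by_contra! hWt
      exact absurd (hmax ⟨⟨hs.1.trans ht.1.le, ht.2⟩, hWt⟩) (not_le.2 ht.1)) s ⟨le_rfl, hs.2⟩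
    have h2 := hYW s (hsub hs) (hYT.trans_le h1)
    have h3 : W s ≤ 0 := hWs
    linarith
  refine not_const_div_le_deriv hT (div_pos hYT hB) hφ0 hd fun t ht ↦ ?_
  have h1 := hanti t ht.1 (fun x hx ↦ hpos x ⟨ht.1.trans hx.1, hx.2⟩) t ⟨le_rfl, ht.2⟩
  have h2 := hYW t ht (hYT.trans_le h1)
  have h3 := hWle t ht (hpos t ht)
  have h4 : 0 < t - α := sub_pos.2 ht.1
  rw [div_div, div_le_iff₀ (by positivity)]
  linarith

/-- A nonnegative solution of `b φ'' - a φ' ≤ k φ` that vanishes at the regular singular endpoint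
`α`, where `b(α) = 0 < b'(α) ≤ -a(α)`, vanishes near `α`. -/
lemma exists_eq_zero_near_endpoint {φ a b : ℝ → ℝ} {α γ β L k : ℝ} (hαγ : α < γ) (hβ : 0 < β)
    (hL : 0 ≤ L) (hk : 0 ≤ k) (hφc : ContinuousOn φ (Icc α γ)) (hφα : φ α = 0)
    (hφ0 : ∀ t ∈ Icc α γ, 0 ≤ φ t) (hφ : ∀ t ∈ Ioo α γ, ContDiffAt ℝ 2 φ t)
    (hbd : ∀ t ∈ Ioo α γ, DifferentiableAt ℝ b t)
    (hb : ∀ᶠ t in 𝓝[>] α, β / 2 * (t - α) ≤ b t ∧ b t ≤ 2 * β * (t - α))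
    (hab : ∀ᶠ t in 𝓝[>] α, a t + deriv b t ≤ L * (t - α))
    (hode : ∀ t ∈ Ioo α γ, b t * deriv (deriv φ) t - a t * deriv φ t ≤ k * φ t) :
    ∃ t ∈ Ioo α γ, φ t = 0 ∧ deriv φ t = 0 := by
  obtain ⟨η, hη, hηev⟩ : ∃ η > α, ∀ t ∈ Ioo α η,
      (β / 2 * (t - α) ≤ b t ∧ b t ≤ 2 * β * (t - α)) ∧ a t + deriv b t ≤ L * (t - α) :=
    (nhdsGT_basis α).eventually_iff.1 (hb.and hab)
  set C₁ := 2 * L / β with hC₁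
  have hC₁0 : 0 ≤ C₁ := by positivity
  -- The flux bound is divided by `b ≥ (β / 2) (t - α)`; the factors `t - α` cancel, leaving a bound
  -- on `φ'` that is uniform up to `α`.
  set C₃ := 2 / β * (Real.exp (C₁ * (γ - α)) * k) with hC₃
  have hC₃0 : 0 ≤ C₃ := by positivity
  have hderiv : ∀ T, α < T → T < η → T < γ → ∀ Φ, (∀ t ∈ Ioc α T, φ t ≤ Φ) →
      deriv φ T ≤ C₃ * Φ := by
    intro T hαT hTη hTγ Φ hΦ
    have hIoo : ∀ t ∈ Ioc α T, t ∈ Ioo α γ := fun t ht ↦ ⟨ht.1, ht.2.trans_lt hTγ⟩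
    have hΦ0 : 0 ≤ Φ := (hφ0 T ⟨hαT.le, hTγ.le⟩).trans (hΦ T ⟨hαT, le_rfl⟩)
    have hflux := flux_le (φ := φ) (W := fun t ↦ b t * deriv φ t)
      (W' := fun t ↦ deriv b t * deriv φ t + b t * deriv (deriv φ) t) (α := α) (T := T)
      (B := 2 * β) (C₁ := C₁) (k := k * Φ) hαT (by positivity) hC₁0 (by positivity)
      (fun t ht ↦ hφ0 t (Ioo_subset_Icc_self (hIoo t ht)))
      (fun t ht ↦ (hφ t (hIoo t ht)).differentiableAt (by simp)) (fun t ht ↦ ?_)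
      (fun t ht hpos ↦ ?_) fun t ht hpos ↦ ?_
    · have h1 := (hηev T ⟨hαT, hTη⟩).1.1
      have hTα : 0 < T - α := sub_pos.2 hαT
      have hexp : Real.exp (C₁ * (T - α)) ≤ Real.exp (C₁ * (γ - α)) := by gcongr
      have h2 : b T * deriv φ T ≤ Real.exp (C₁ * (γ - α)) * (k * Φ * (T - α)) :=
        hflux.trans (by gcongr)
      by_contra! hlt
      have hpos : 0 < deriv φ T := (by positivity : 0 ≤ C₃ * Φ).trans_lt hlt
      have h3 : β / 2 * (T - α) * (C₃ * Φ) < b T * deriv φ T :=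
        calc _ < β / 2 * (T - α) * deriv φ T := by gcongr
          _ ≤ _ := by gcongr
      have h4 : β / 2 * (T - α) * (C₃ * Φ) =
          Real.exp (C₁ * (γ - α)) * (k * Φ * (T - α)) := by
        rw [hC₃]; field_simp
      linarith
    · have h := hφ t (hIoo t ht)
      have h' : ContDiffAt ℝ 1 (deriv φ) t := h.derivWithin (by norm_num)
      exact (hbd t (hIoo t ht)).hasDerivAt.mul (h'.differentiableAt (by simp)).hasDerivAt
    all_goals
      have ht' : 0 < t - α := sub_pos.2 ht.1
      obtain ⟨⟨hb1, hb2⟩, hab'⟩ := hηev t ⟨ht.1, ht.2.trans_lt hTη⟩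
      have hbpos : 0 < b t := (by positivity : 0 < β / 2 * (t - α)).trans_le hb1
      have hφ'pos : 0 < deriv φ t := (pos_iff_pos_of_mul_pos hpos).1 hbpos
    · gcongr
    · have h1 := hode t (hIoo t ht)
      have h2 : (a t + deriv b t) * deriv φ t ≤ L * (t - α) * deriv φ t := by gcongr
      have h3 : L * (t - α) ≤ C₁ * b t := by
        calc L * (t - α) = C₁ * (β / 2 * (t - α)) := by rw [hC₁]; field_simp
          _ ≤ _ := by gcongr
      have h4 : L * (t - α) * deriv φ t ≤ C₁ * b t * deriv φ t := by gcongr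
      have h5 : k * φ t ≤ k * Φ := by gcongr; exact hΦ t ht
      linarith
  -- On so short an interval the mean value bound `φ T ≤ C₃ (T - α) φ T` at a maximum point `T`
  -- leaves no positive maximum.
  obtain ⟨δ, hδ, hδη, hδγ, hδC⟩ : ∃ δ > α, δ < η ∧ δ < γ ∧ C₃ * (δ - α) < 1 := by
    refine ⟨α + min (min (η - α) (γ - α)) (1 / (C₃ + 1)) / 2, ?_⟩
    set r := min (min (η - α) (γ - α)) (1 / (C₃ + 1)) with hr
    have hr0 : 0 < r := lt_min (lt_min (sub_pos.2 hη) (sub_pos.2 hαγ)) (by positivity)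
    have h1 : r ≤ η - α := (min_le_left _ _).trans (min_le_left _ _)
    have h2 : r ≤ γ - α := (min_le_left _ _).trans (min_le_right _ _)
    have h3 : r ≤ 1 / (C₃ + 1) := min_le_right _ _
    refine ⟨by linarith, by linarith, by linarith, ?_⟩
    rw [le_div_iff₀ (by positivity)] at h3
    have : 0 ≤ C₃ * r := by positivity
    rw [add_sub_cancel_left]
    linarith
  obtain ⟨T, hT, hmax⟩ := (isCompact_Icc (a := α) (b := δ)).exists_isMaxOn
    ⟨α, le_rfl, hδ.le⟩ (hφc.mono (Icc_subset_Icc_right hδγ.le))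
  have hΦ : φ T ≤ 0 := by
    rcases hT.1.eq_or_lt with rfl | hαT
    · exact hφα.le
    have hsub : Icc α T ⊆ Icc α γ := Icc_subset_Icc_right (hT.2.trans hδγ.le)
    have hmv := Convex.image_sub_le_mul_sub_of_deriv_le (f := φ) (C := C₃ * φ T) (convex_Icc α T)
      (hφc.mono hsub) (fun t ht ↦ ?_) (fun t ht ↦ ?_) α ⟨le_rfl, hαT.le⟩ T ⟨hαT.le, le_rfl⟩ hαT.le
    · rw [hφα, sub_zero] at hmv
      have h0 := hφ0 T (hsub ⟨hαT.le, le_rfl⟩)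
      have h1 : C₃ * φ T * (T - α) ≤ C₃ * (δ - α) * φ T := by
        have : C₃ * φ T * (T - α) ≤ C₃ * φ T * (δ - α) := by gcongr; exact hT.2
        linarith
      by_contra! hpos
      have := mul_lt_of_lt_one_left hpos hδC
      linarith
    · rw [interior_Icc] at ht
      exact ((hφ t ⟨ht.1, ht.2.trans_le (hT.2.trans hδγ.le)⟩).differentiableAt
        (by simp)).differentiableWithinAt
    · rw [interior_Icc] at ht
      have h1 := ht.2.trans_le hT.2
      exact hderiv t ht.1 (h1.trans hδη) (h1.trans hδγ) _ fun x hx ↦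
        hmax ⟨hx.1.le, hx.2.trans h1.le⟩
  have hzero : ∀ t ∈ Icc α δ, φ t = 0 := fun t ht ↦
    le_antisymm ((hmax ht).trans hΦ) (hφ0 t ⟨ht.1, ht.2.trans hδγ.le⟩)
  have hmid : (α + δ) / 2 ∈ Ioo α δ := ⟨by linarith [hδ.lt], by linarith [hδ.lt]⟩
  refine ⟨(α + δ) / 2, ⟨hmid.1, hmid.2.trans hδγ⟩, hzero _ (Ioo_subset_Icc_self hmid), ?_⟩
  have : φ =ᶠ[𝓝 ((α + δ) / 2)] fun _ ↦ 0 := by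
    filter_upwards [Icc_mem_nhds hmid.1 hmid.2] with t ht using hzero t ht
  rw [this.deriv_eq, deriv_const]

end ODE

/-! ### Regularity of `φ` from that of `φ ∘ f`. -/

lemma contDiffAt_of_comp {φ l : ℝ → ℝ} {l' t : ℝ} {k : WithTop ℕ∞} (hk : 1 ≤ k)
    (hl : ContDiffAt ℝ k l t) (hl' : HasDerivAt l l' t) (h0 : l' ≠ 0)
    (h : ContDiffAt ℝ k (φ ∘ l) t) : ContDiffAt ℝ k φ (l t) := by
  have hk0 : k ≠ 0 := (zero_lt_one.trans_le hk).ne'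
  let e : ℝ ≃L[ℝ] ℝ := ContinuousLinearEquiv.unitsEquivAut ℝ (Units.mk0 l' h0)
  have he : HasFDerivAt l (e : ℝ →L[ℝ] ℝ) t := by
    refine hl'.hasFDerivAt.congr_fderiv ?_
    ext
    simp [e]
  have hs := hl.hasStrictFDerivAt' he hk0
  -- Locally `φ` is `φ ∘ l` composed with the inverse of `l`.
  have hinv : ContDiffAt ℝ k (hl.localInverse he hk0) (l t) := hl.to_localInverse he hk0
  have himg : hl.localInverse he hk0 (l t) = t := hl.localInverse_apply_image he hk0
  have hcomp : ContDiffAt ℝ k ((φ ∘ l) ∘ hl.localInverse he hk0) (l t) :=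
    ContDiffAt.comp _ (by rwa [himg]) hinv
  refine hcomp.congr_of_eventuallyEq ?_
  filter_upwards [hs.eventually_right_inverse] with x hx
  exact congrArg φ hx.symm

section Regularity

variable {n : ℕ} {M : Type*} [TopologicalSpace M] [ChartedSpace (EuclideanSpace ℝ (Fin n)) M]
  [IsManifold (𝓡 n) ∞ M] [RiemannianBundle (fun x : M ↦ TangentSpace (𝓡 n) x)]

/-- Where `f` has no critical point, `φ` is as regular as `φ ∘ f`. -/
lemma contDiffAt_of_contMDiffAt_comp {f : M → ℝ} (hf : ContMDiff (𝓡 n) 𝓘(ℝ, ℝ) ∞ f) {x₀ : M}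
    (hgrad : ‖grad n f x₀‖ ≠ 0) {φ : ℝ → ℝ} (h : ContMDiffAt (𝓡 n) 𝓘(ℝ, ℝ) 2 (φ ∘ f) x₀) :
    ContDiffAt ℝ 2 φ (f x₀) := by
  set ψ := chartAt (EuclideanSpace ℝ (Fin n)) x₀
  have hψ : ψ ∈ IsManifold.maximalAtlas (𝓡 n) ∞ M := IsManifold.chart_mem_maximalAtlas x₀
  have hxs : x₀ ∈ ψ.source := mem_chart_source _ x₀
  have hy : ψ x₀ ∈ ψ.target := ψ.map_source hxs
  have hsx : ψ.symm (ψ x₀) = x₀ := ψ.left_inv hxs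
  have hF : ContDiffAt ℝ ∞ (f ∘ ψ.symm) (ψ x₀) := contDiffAt_comp_symm hψ hy le_rfl (hf _)
  have hU : ContDiffAt ℝ 2 ((φ ∘ f) ∘ ψ.symm) (ψ x₀) :=
    contDiffAt_comp_symm hψ hy (by simp [ENat.LEInfty.out]) (by rwa [hsx])
  -- On a coordinate line along which `f` has nonzero derivative, the question is one-dimensional.
  obtain ⟨i, hi⟩ : ∃ i, partialDeriv i (f ∘ ψ.symm) (ψ x₀) ≠ 0 := by
    by_contra! hall
    have := norm_grad_sq hψ hy ((hf (ψ.symm (ψ x₀))).mdifferentiableAt (by simp))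
    rw [hsx] at this
    simp only [hall, mul_zero, Finset.sum_const_zero] at this
    exact hgrad (pow_eq_zero_iff two_ne_zero |>.1 this)
  set v : EuclideanSpace ℝ (Fin n) := EuclideanSpace.single i 1
  have hline : ContDiffAt ℝ ∞ (fun t : ℝ ↦ ψ x₀ + t • v) 0 := by fun_prop
  have h0 : ψ x₀ + (0 : ℝ) • v = ψ x₀ := by simp
  have hl : ContDiffAt ℝ ∞ ((f ∘ ψ.symm) ∘ fun t : ℝ ↦ ψ x₀ + t • v) 0 :=
    ContDiffAt.comp (0 : ℝ) (by rwa [h0]) hline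
  have hl' : HasDerivAt ((f ∘ ψ.symm) ∘ fun t : ℝ ↦ ψ x₀ + t • v)
      (partialDeriv i (f ∘ ψ.symm) (ψ x₀)) 0 := by
    refine HasFDerivAt.comp_hasDerivAt (0 : ℝ) ?_ (hasDerivAt_line (ψ x₀) v 0)
    rw [h0]
    exact (hF.differentiableAt (by simp)).hasFDerivAt
  have hcomp : ContDiffAt ℝ 2 (((φ ∘ f) ∘ ψ.symm) ∘ fun t : ℝ ↦ ψ x₀ + t • v) 0 :=
    ContDiffAt.comp (0 : ℝ) (by rwa [h0]) (hline.of_le (by simp [ENat.LEInfty.out]))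
  have := contDiffAt_of_comp (φ := φ) one_le_two (hl.of_le (by simp [ENat.LEInfty.out])) hl' hi
    hcomp
  simpa [hsx] using this

end Regularity

/-! ### The symmetry `f ↦ -f`. -/

section Neg

variable {n : ℕ} {M : Type*}

lemma minLevel_neg (f : M → ℝ) : minLevel (fun x ↦ -f x) = maxLevel f := by
  ext x; simp [minLevel, maxLevel]

lemma maxLevel_neg (f : M → ℝ) : maxLevel (fun x ↦ -f x) = minLevel f := by
  ext x; simp [minLevel, maxLevel]

lemma focalSet_neg (f : M → ℝ) : focalSet (fun x ↦ -f x) = focalSet f := by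
  rw [focalSet, minLevel_neg, maxLevel_neg, union_comm, focalSet]

lemma IsInvariant.neg {f u : M → ℝ} (h : IsInvariant f u) : IsInvariant (fun x ↦ -f x) u :=
  fun x y hxy ↦ h x y (neg_injective hxy)

variable [TopologicalSpace M] [ChartedSpace (EuclideanSpace ℝ (Fin n)) M]
  [RiemannianBundle (fun x : M ↦ TangentSpace (𝓡 n) x)]

lemma norm_grad_neg (f : M → ℝ) (x : M) : ‖grad n (fun x ↦ -f x) x‖ = ‖grad n f x‖ := by
  have h : grad n (fun x ↦ -f x) x = -grad n f x := by
    refine ext_inner_right ℝ fun v ↦ ?_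
    rw [inner_neg_left, inner_grad, inner_grad]
    have : mfderiv (𝓡 n) 𝓘(ℝ, ℝ) (fun x ↦ -f x) x = -mfderiv (𝓡 n) 𝓘(ℝ, ℝ) f x :=
      mfderiv_neg
    rw [this]
    rfl
  rw [h, norm_neg]

lemma laplacian_neg (f : M → ℝ) (x : M) : laplacian n (fun x ↦ -f x) x = -laplacian n f x := by
  have hp : ∀ (i : Fin n) (h : EuclideanSpace ℝ (Fin n) → ℝ),
      partialDeriv i (fun y ↦ -h y) = fun y ↦ -partialDeriv i h y := by
    intro i h
    ext y
    simp [partialDeriv, fderiv_fun_neg]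
  have hc : ∀ ψ : OpenPartialHomeomorph M (EuclideanSpace ℝ (Fin n)),
      (fun x ↦ -f x) ∘ ψ.symm = fun y ↦ -(f ∘ ψ.symm) y := fun _ ↦ rfl
  simp only [laplacian, hc, hp, mul_neg, Finset.sum_neg_distrib]

lemma IsProperIsoparametric.neg [CompactSpace M] [ConnectedSpace M] {f : M → ℝ}
    (hf : IsProperIsoparametric n f) : IsProperIsoparametric n (fun x ↦ -f x) := by
  have hcont := hf.contMDiff.continuous
  have hinf : ⨅ x, -f x = -⨆ x, f x := by
    obtain ⟨x, hx⟩ := (isCompact_range hcont).isGreatest_sSup (range_nonempty f) |>.1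
    have h1 : x ∈ maxLevel f := (mem_maxLevel_iff hcont).2 hx
    rw [← minLevel_neg] at h1
    rw [← eq_iInf_of_mem_minLevel h1, hx]
    rfl
  have hsup : ⨆ x, -f x = -⨅ x, f x := by
    obtain ⟨x, hx⟩ := (isCompact_range hcont).isLeast_sInf (range_nonempty f) |>.1
    have h1 : x ∈ minLevel f := (mem_minLevel_iff hcont).2 hx
    rw [← maxLevel_neg] at h1
    rw [← eq_iSup_of_mem_maxLevel h1, hx]
    rfl
  have hmaps : MapsTo (fun t : ℝ ↦ -t) (Icc (⨅ x, -f x) (⨆ x, -f x)) (Icc (⨅ x, f x) (⨆ x, f x)) :=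
    fun t ht ↦ by
      rw [hinf, hsup] at ht
      exact ⟨by linarith [ht.2], by linarith [ht.1]⟩
  obtain ⟨b, hb, hbg⟩ := hf.exists_gradient
  obtain ⟨a, ha, hal⟩ := hf.exists_laplacian
  refine ⟨⟨hf.contMDiff.neg, ?_, ⟨fun t ↦ b (-t), hb.comp contDiff_neg.contDiffOn hmaps, ?_⟩,
    ⟨fun t ↦ -a (-t), (ha.comp contDiff_neg.contDiffOn hmaps).neg, ?_⟩⟩, ?_, ?_⟩
  · obtain ⟨x, y, h⟩ := hf.nonconstant
    exact ⟨x, y, fun h' ↦ h (neg_injective h')⟩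
  · intro x; simp only [norm_grad_neg, hbg, neg_neg]
  · intro x; simp only [laplacian_neg, hal, neg_neg]
  · rw [minLevel_neg]; exact hf.maxLevel_codim
  · rw [maxLevel_neg]; exact hf.minLevel_codim

end Neg

/-! ### Continuity of the profile of an invariant function. -/

section Invariant

variable {M : Type*} [TopologicalSpace M] [CompactSpace M]

/-- Compactness makes `f` a closed map, so continuity descends to its range, including the two focal
values. -/
lemma continuousOn_range_of_comp {f : M → ℝ} (hf : Continuous f) {φ : ℝ → ℝ}
    (h : Continuous (φ ∘ f)) : ContinuousOn φ (range f) := by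
  refine continuousOn_iff_isClosed.2 fun t ht ↦
    ⟨f '' ((φ ∘ f) ⁻¹' t), ((ht.preimage h).isCompact.image hf).isClosed, ?_⟩
  ext s
  constructor
  · rintro ⟨hs, x, rfl⟩
    exact ⟨⟨x, hs, rfl⟩, x, rfl⟩
  · rintro ⟨⟨x, hx, rfl⟩, hs⟩
    exact ⟨hx, hs⟩

end Invariant

/-! ### The maximum principle. -/

section MaximumPrinciple

variable {n : ℕ} {M : Type*} [MetricSpace M] [CompactSpace M] [ConnectedSpace M]
  [ChartedSpace (EuclideanSpace ℝ (Fin n)) M] [IsManifold (𝓡 n) ∞ M]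
  [RiemannianBundle (fun x : M ↦ TangentSpace (𝓡 n) x)]
  [IsContMDiffRiemannianBundle (𝓡 n) ∞ (EuclideanSpace ℝ (Fin n))
    (fun x : M ↦ TangentSpace (𝓡 n) x)]

/-- An invariant solution which vanishes off the maximum level vanishes identically. -/
lemma eq_zero_of_eq_zero_of_notMem_maxLevel {f : M → ℝ} (hf : IsProperIsoparametric n f)
    {K : M → ℝ} (hK : Continuous K) {s q : ℝ} (hq : 2 < q) {u : M → ℝ} (hu : Continuous u)
    (hu2 : ContMDiffOn (𝓡 n) 𝓘(ℝ, ℝ) 2 u (focalSet f)ᶜ) (huf : IsInvariant f u)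
    (hu0 : ∀ x, 0 ≤ u x)
    (heq : ∀ x ∈ (focalSet f)ᶜ, laplacian n u x + K x * u x =
      u x ^ (q - 1) / Metric.infDist x (focalSet f) ^ s)
    {x₀ : M} (hx₀ : x₀ ∉ maxLevel f) (hux₀ : u x₀ = 0) : ∀ x, u x = 0 := by
  have hfs := hf.contMDiff
  have hfc := hfs.continuous
  have hne := hf.nonconstant
  obtain ⟨b, hb, hgrad⟩ := hf.exists_gradient
  obtain ⟨a, ha, hlap⟩ := hf.exists_laplacian
  have hr := range_eq_Icc hfc
  have hαγ := iInf_lt_iSup hfc hne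
  have hmemI := fun {x} ↦ notMem_focalSet_iff hfc (x := x)
  set α := ⨅ x, f x with hα
  set γ := ⨆ x, f x with hγ
  obtain ⟨φ, rfl⟩ : ∃ φ : ℝ → ℝ, u = φ ∘ f :=
    (Function.factorsThrough_iff u).1 fun x y h ↦ huf x y h
  have hbpos : ∀ t ∈ Ioo α γ, 0 < b t := fun t ht ↦ profile_pos hfs hne hb hgrad ht
  have hSopen : IsOpen (focalSet f)ᶜ := by
    have : (focalSet f)ᶜ = f ⁻¹' Ioo α γ := ext fun x ↦ hmemI
    rw [this]
    exact isOpen_Ioo.preimage hfc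
  have hφ : ∀ t ∈ Ioo α γ, ContDiffAt ℝ 2 φ t := by
    intro t ht
    obtain ⟨x, rfl⟩ : t ∈ range f := hr ▸ Ioo_subset_Icc_self ht
    refine contDiffAt_of_contMDiffAt_comp hfs (fun h ↦ ?_)
      ((hu2 x (hmemI.2 ht)).contMDiffAt (hSopen.mem_nhds (hmemI.2 ht)))
    have := hbpos _ ht
    rw [← hgrad, h] at this
    simp at this
  have hφc : ContinuousOn φ (Icc α γ) := hr ▸ continuousOn_range_of_comp hfc hu
  have hφ0 : ∀ t ∈ Icc α γ, 0 ≤ φ t := by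
    intro t ht
    obtain ⟨x, rfl⟩ : t ∈ range f := hr ▸ ht
    exact hu0 x
  have hode : ∀ x, f x ∈ Ioo α γ → b (f x) * deriv (deriv φ) (f x) - a (f x) * deriv φ (f x) =
      K x * φ (f x) - φ (f x) ^ (q - 1) / Metric.infDist x (focalSet f) ^ s := by
    intro x hx
    have h1 := heq x (hmemI.2 hx)
    rw [laplacian_comp hfs (hφ _ hx), hgrad, hlap] at h1
    simp only [Function.comp] at h1
    linarith
  -- Vanishing Cauchy data at one interior point suffice, by uniqueness on `(α, γ)` and continuity
  -- at the endpoints.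
  suffices hmain : ∃ t ∈ Ioo α γ, φ t = 0 ∧ deriv φ t = 0 by
    obtain ⟨c, hc, hc0, hc1⟩ := hmain
    have hzero := eq_zero_of_abs_deriv_deriv_le hc hφ (fun p r hp hrγ ↦ ?_) hc0 hc1
    · have : EqOn φ (fun _ ↦ 0) (Icc α γ) :=
        EqOn.of_subset_closure (s := Ioo α γ) (fun t ht ↦ hzero t ht) hφc continuousOn_const
          Ioo_subset_Icc_self (closure_Ioo hαγ.ne).ge
      exact fun x ↦ this (hr ▸ mem_range_self x)
    · have hcomp : IsCompact (f ⁻¹' Icc p r) := (isClosed_Icc.preimage hfc).isCompact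
      have hsub : ∀ x ∈ f ⁻¹' Icc p r, f x ∈ Ioo α γ := fun x hx ↦
        ⟨hp.trans_le hx.1, hx.2.trans_lt hrγ⟩
      have hcb : ContinuousOn (fun x ↦ b (f x)) (f ⁻¹' Icc p r) :=
        hb.continuousOn.comp hfc.continuousOn fun x hx ↦ Ioo_subset_Icc_self (hsub x hx)
      have hca : ContinuousOn (fun x ↦ a (f x)) (f ⁻¹' Icc p r) :=
        ha.continuousOn.comp hfc.continuousOn fun x hx ↦ Ioo_subset_Icc_self (hsub x hx)
      have hdist : ∀ x ∈ f ⁻¹' Icc p r, 0 < Metric.infDist x (focalSet f) := by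
        intro x hx
        obtain ⟨z, hz⟩ : α ∈ range f := hr ▸ left_mem_Icc.2 hαγ.le
        have hne : (focalSet f).Nonempty := ⟨z, Or.inl ((mem_minLevel_iff hfc).2 hz)⟩
        exact ((isOpen_compl_iff.1 hSopen).notMem_iff_infDist_pos hne).1 (hmemI.2 (hsub x hx))
      obtain ⟨C₁, hC₁⟩ := hcomp.exists_bound_of_continuousOn
        (hca.div hcb fun x hx ↦ (hbpos _ (hsub x hx)).ne')
      have hcc : ContinuousOn (fun x ↦ (K x - φ (f x) ^ (q - 2) /
          Metric.infDist x (focalSet f) ^ s) / b (f x)) (f ⁻¹' Icc p r) := by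
        refine ContinuousOn.div (hK.continuousOn.sub (ContinuousOn.div ?_ ?_ ?_)) hcb
          fun x hx ↦ (hbpos _ (hsub x hx)).ne'
        · exact hu.continuousOn.rpow_const fun x _ ↦ Or.inr (by linarith)
        · exact (Metric.continuous_infDist_pt _).continuousOn.rpow_const
            fun x hx ↦ Or.inl (hdist x hx).ne'
        · exact fun x hx ↦ (Real.rpow_pos_of_pos (hdist x hx) _).ne'
      obtain ⟨C₂, hC₂⟩ := hcomp.exists_bound_of_continuousOn hcc
      refine ⟨max C₁ C₂, fun t ht ↦ ?_⟩
      obtain ⟨x, rfl⟩ : t ∈ range f := hr ▸ ⟨hp.le.trans ht.1, ht.2.trans hrγ.le⟩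
      have hb0 := hbpos _ (hsub x ht)
      -- Here `q > 2` enters: `φ^(q-2)` stays continuous at zeros of `φ`, so the equation is linear
      -- with bounded coefficients on compact subintervals.
      have hpow : φ (f x) ^ (q - 1) = φ (f x) * φ (f x) ^ (q - 2) := by
        have : q - 1 = 1 + (q - 2) := by ring
        have h0 : 0 ≤ φ (f x) := hu0 x
        rw [this, Real.rpow_add_of_nonneg h0 zero_le_one (by linarith), Real.rpow_one]
      have h2 : deriv (deriv φ) (f x) = a (f x) / b (f x) * deriv φ (f x) +
          (K x - φ (f x) ^ (q - 2) / Metric.infDist x (focalSet f) ^ s) / b (f x) * φ (f x) := by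
        have h1 := hode x (hsub x ht)
        rw [hpow, mul_div_assoc] at h1
        rw [div_mul_eq_mul_div, div_mul_eq_mul_div, ← add_div, eq_div_iff hb0.ne']
        linarith
      rw [h2]
      refine (abs_add_le _ _).trans ?_
      rw [abs_mul, abs_mul, add_comm, mul_add]
      gcongr
      · exact (hC₂ x ht).trans (le_max_right _ _)
      · exact (hC₁ x ht).trans (le_max_left _ _)
  have hfx₀ : f x₀ ∈ Icc α γ := hr ▸ mem_range_self x₀
  have hfx₀γ : f x₀ < γ := hfx₀.2.lt_of_ne fun h ↦ hx₀ ((mem_maxLevel_iff hfc).2 h)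
  rcases hfx₀.1.lt_or_eq with hlt | hxα
  · refine ⟨f x₀, ⟨hlt, hfx₀γ⟩, hux₀, IsLocalMin.deriv_eq_zero ?_⟩
    filter_upwards [Icc_mem_nhds hlt hfx₀γ] with t ht
    exact (le_of_eq hux₀).trans (hφ0 t ht)
  have hx₀min : x₀ ∈ minLevel f := (mem_minLevel_iff hfc).2 hxα.symm
  have hαI : α ∈ Icc α γ := left_mem_Icc.2 hαγ.le
  have hu := uniqueDiffOn_Icc hαγ
  have hbα : b α = 0 := profile_iInf_eq_zero hfs hne hgrad
  set β := derivWithin b (Icc α γ) α with hβdef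
  have hbβ : HasDerivWithinAt b β (Icc α γ) α :=
    (hb.differentiableOn (by simp) α hαI).hasDerivWithinAt
  have hIoi : 𝓝[>] α ≤ 𝓝[Icc α γ] α := by
    rw [← nhdsWithin_Ioo_eq_nhdsGT hαγ]
    exact nhdsWithin_mono _ Ioo_subset_Icc_self
  -- Nonzero because the zero of `b` is simple, nonnegative as a limit of difference quotients of `b
  -- ≥ 0`.
  have hβ : 0 < β := by
    refine lt_of_le_of_ne ?_ (derivWithin_ne_zero_of_eq_zero hfs hne hb hgrad hαI hbα).symm
    have := hasDerivWithinAt_iff_tendsto_slope.1 (hbβ.mono (Ioo_subset_Icc_self))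
    have hIoo : Ioo α γ \ {α} = Ioo α γ := sdiff_singleton_eq_self (by simp)
    rw [hIoo, nhdsWithin_Ioo_eq_nhdsGT hαγ] at this
    refine ge_of_tendsto this ?_
    filter_upwards [Ioo_mem_nhdsGT hαγ] with t ht
    rw [slope_def_field, hbα, sub_zero]
    exact div_nonneg (hbpos t ht).le (sub_pos.2 ht.1).le
  obtain ⟨d, hd, hsub⟩ := hf.minLevel_codim x₀ hx₀min
  have hle : β ≤ -a α := by
    have := le_neg_laplacian_of_mem_minLevel hfs (I := Icc α γ) (fun x ↦ hr ▸ mem_range_self x)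
      hx₀min hβ (hxα ▸ hbβ) (hxα ▸ hbα) hgrad hd hsub
    rwa [hlap, ← hxα] at this
  -- Differentiability together with `a(α) + b'(α) ≤ 0` gives the one-sided bound `a + b' ≤ L (t -
  -- α)`.
  have hdb : DifferentiableWithinAt ℝ (fun t ↦ a t + derivWithin b (Icc α γ) t) (Icc α γ) α := by
    have hb' : ContDiffOn ℝ 1 (derivWithin b (Icc α γ)) (Icc α γ) :=
      hb.derivWithin hu (by norm_cast)
    exact (ha.differentiableOn (by simp) α hαI).add (hb'.differentiableOn (by simp) α hαI)
  obtain ⟨L, hL, hLO⟩ := hdb.isBigO_sub.exists_pos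
  obtain ⟨k, hk⟩ := isCompact_univ.exists_bound_of_continuousOn hK.continuousOn
  have hk0 : 0 ≤ k := (norm_nonneg _).trans (hk x₀ (mem_univ _))
  refine exists_eq_zero_near_endpoint (a := a) (b := b) (k := k) hαγ hβ hL.le hk0 hφc
    (by rw [hxα]; exact hux₀) hφ0 hφ (fun t ht ↦ ?_) ?_ ?_ fun t ht ↦ ?_
  · exact (hb.contDiffAt (Icc_mem_nhds ht.1 ht.2)).differentiableAt (by simp)
  · have := (hasDerivWithinAt_iff_isLittleO.1 hbβ).bound (half_pos hβ)
    filter_upwards [this.filter_mono hIoi, self_mem_nhdsWithin] with t ht htα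
    have htα : 0 < t - α := sub_pos.2 htα
    rw [hbα, sub_zero, smul_eq_mul, Real.norm_of_nonneg htα.le, Real.norm_eq_abs, abs_le] at ht
    have : 0 < β * (t - α) := by positivity
    constructor <;> linarith [ht.1, ht.2]
  · filter_upwards [hLO.bound.filter_mono hIoi, Ioo_mem_nhdsGT hαγ] with t ht htα
    have htα' : 0 < t - α := sub_pos.2 htα.1
    rw [Real.norm_of_nonneg htα'.le, derivWithin_of_mem_nhds (Icc_mem_nhds htα.1 htα.2)] at ht
    have := (le_abs_self _).trans ht
    linarith
  · obtain ⟨x, rfl⟩ : t ∈ range f := hr ▸ Ioo_subset_Icc_self ht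
    rw [hode x ht]
    have h1 : 0 ≤ φ (f x) := hu0 x
    have h2 : K x * φ (f x) ≤ k * φ (f x) := by
      gcongr
      exact (le_abs_self _).trans (hk x (mem_univ _))
    -- The singular term has the favourable sign and is dropped, so its blow-up at the focal set
    -- does no harm.
    have h3 : 0 ≤ φ (f x) ^ (q - 1) / Metric.infDist x (focalSet f) ^ s :=
      div_nonneg (Real.rpow_nonneg h1 _) (Real.rpow_nonneg Metric.infDist_nonneg _)
    linarith

end MaximumPrinciple

end Isoparametric

end

theorem theorem1p1 {n : ℕ} (hn : 3 ≤ n)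
    {M : Type*} [MetricSpace M] [CompactSpace M] [ConnectedSpace M]
    [ChartedSpace (EuclideanSpace ℝ (Fin n)) M] [IsManifold (𝓡 n) ∞ M]
    [RiemannianBundle (fun x : M ↦ TangentSpace (𝓡 n) x)]
    [IsContMDiffRiemannianBundle (𝓡 n) ∞ (EuclideanSpace ℝ (Fin n))
      (fun x : M ↦ TangentSpace (𝓡 n) x)]
    [IsRiemannianManifold (𝓡 n) M]
    (f : M → ℝ) (hf : Isoparametric.IsProperIsoparametric n f)
    (K : M → ℝ) (hK : Continuous K) (hKf : Isoparametric.IsInvariant f K)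
    (s q : ℝ) (hs : s ∈ Ioo (0 : ℝ) 2) (hq : 2 < q)
    (u : M → ℝ) (hu : Continuous u)
    (hu2 : ContMDiffOn (𝓡 n) 𝓘(ℝ, ℝ) 2 u (Isoparametric.focalSet f)ᶜ)
    (huf : Isoparametric.IsInvariant f u) (hu0 : ∀ x, 0 ≤ u x)
    (heq : ∀ x ∈ (Isoparametric.focalSet f)ᶜ,
      Isoparametric.laplacian n u x + K x * u x =
        u x ^ (q - 1) / Metric.infDist x (Isoparametric.focalSet f) ^ s) :
    (∀ x, u x = 0) ∨ (∀ x, 0 < u x) := by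
  by_cases hzero : ∃ x, u x = 0
  · obtain ⟨x₀, hx₀⟩ := hzero
    left
    by_cases hmax : x₀ ∈ Isoparametric.maxLevel f
    · have hmin : x₀ ∉ Isoparametric.minLevel f := fun hmin ↦ by
        obtain ⟨x, y, hxy⟩ := hf.nonconstant
        exact hxy (((hmax x).antisymm (hmin x)).trans ((hmax y).antisymm (hmin y)).symm)
      refine Isoparametric.eq_zero_of_eq_zero_of_notMem_maxLevel hf.neg hK (s := s) hq hu ?_
        huf.neg hu0 ?_ (x₀ := x₀) ?_ hx₀
      · rwa [Isoparametric.focalSet_neg]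
      · rwa [Isoparametric.focalSet_neg]
      · rwa [Isoparametric.maxLevel_neg]
    · exact Isoparametric.eq_zero_of_eq_zero_of_notMem_maxLevel hf hK hq hu hu2 huf hu0 heq hmax
        hx₀
  · push Not at hzero
    exact Or.inr fun x ↦ (hu0 x).lt_of_ne (hzero x).symm
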